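/- Let $\mathbb{D}$ be the open unit disc and $1\le p<\infty$. Let $RM(p,1)$ be the space of holomorphic functions $f:\mathbb{D}\to\mathbb{C}$ with $$\rho_{p,1}(f)=\frac1{2\pi}\int_0^{2\pi}\Big(\int_0^1|f(re^{it})|^p\,dr\Big)^{1/p}dt<\infty,$$ normed by $\rho_{p,1}$. Let $\mathcal{B}$ (the Bloch space) be the set of holomorphic $g:\mathbb{D}\to\mathbb{C}$ with $\sup_{z\in\mathbb{D}}(1-|z|^2)|g'(z)|<\infty$, and let $\mathcal{B}_0$ (the little Bloch space) be the set of those $g\in\mathcal{B}$ with $\lim_{|z|\to1^-}(1-|z|^2)|g'(z)|=0$. Let $g\in\mathcal{B}$. Then the integration operator $$T_g(f)(z)=\int_0^z f(w)\,g'(w)\,dw\qquad(z\in\mathbb{D})$$ is a well-defined bounded linear operator $T_g:RM(p,1)\to RM(p,1)$, and the following are equivalent: (a) $T_g:RM(p,1)\to RM(p,1)$ is weakly compact, that is, the image of the closed unit ball is relatively compact in the weak topology; (b) $T_g:RM(p,1)\to RM(p,1)$ is compact; (c) $g\in\mathcal{B}_0$. -/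

import Mathlib

open MeasureTheory Filter Topology Metric
open scoped ENNReal

noncomputable section

/-- The quantity `ρ_{p,q}(f)` for finite `p` and `q`, with values in `[0, ∞]`:
`((1/2π) ∫_0^{2π} (∫_0^1 |f(r e^{it})|^p dr)^{q/p} dt)^{1/q}`. -/
def rho (p q : ℝ) (f : ℂ → ℂ) : ℝ≥0∞ :=
  (ENNReal.ofReal (1 / (2 * Real.pi)) *
    ∫⁻ t in Set.Ico (0 : ℝ) (2 * Real.pi),
      (∫⁻ r in Set.Ico (0 : ℝ) 1,
        ‖f ((r : ℂ) * Complex.exp ((t : ℂ) * Complex.I))‖ₑ ^ p) ^ (q / p)) ^ (1 / q)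

/-- The value of a function at the point of the plane with polar coordinates `(r, t)`. -/
def polarVal (f : ℂ → ℂ) (t r : ℝ) : ℂ := f ((r : ℂ) * Complex.exp ((t : ℂ) * Complex.I))

/-- The set of holomorphic functions on the unit disc with `ρ_{p,q}(f) < ∞`. A function on the open
unit disc is represented by its extension by zero to the plane. -/
def rmSet (p q : ℝ) : Set (ℂ → ℂ) :=
  {f | DifferentiableOn ℂ f (ball 0 1) ∧ (∀ z ∉ ball (0 : ℂ) 1, f z = 0) ∧ rho p q f < ∞}

theorem measurable_of_holo {f : ℂ → ℂ} (hf : DifferentiableOn ℂ f (ball 0 1))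
    (h0 : ∀ z ∉ ball (0 : ℂ) 1, f z = 0) : Measurable f := by
  classical
  have h : f = (ball (0 : ℂ) 1).piecewise f 0 := by
    funext z
    by_cases hz : z ∈ ball (0 : ℂ) 1
    · simp [Set.piecewise, hz]
    · rw [Set.piecewise_eq_of_notMem _ _ _ hz, h0 z hz]; rfl
  rw [h]
  exact hf.continuousOn.measurable_piecewise continuousOn_const measurableSet_ball

theorem measurable_polarVal {f : ℂ → ℂ} (hf : Measurable f) :
    Measurable (Function.uncurry (polarVal f)) := by
  have hc : Continuous fun x : ℝ × ℝ => (x.2 : ℂ) * Complex.exp ((x.1 : ℂ) * Complex.I) := by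
    fun_prop
  exact hf.comp hc.measurable

/-- The `L^p` norm of `f` along the radius with angle `t`. -/
def radial (p : ℝ) (f : ℂ → ℂ) (t : ℝ) : ℝ≥0∞ :=
  (∫⁻ r in Set.Ico (0 : ℝ) 1, ‖polarVal f t r‖ₑ ^ p) ^ (1 / p)

theorem measurable_radial (p : ℝ) {f : ℂ → ℂ} (hf : Measurable f) : Measurable (radial p f) := by
  have h : Measurable (fun x : ℝ × ℝ => ‖Function.uncurry (polarVal f) x‖ₑ ^ p) :=
    (measurable_polarVal hf).enorm.pow_const p
  exact (Measurable.lintegral_prod_right' (ν := volume.restrict (Set.Ico (0 : ℝ) 1)) h).pow_const _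

theorem rho_eq (p q : ℝ) (hq : 1 ≤ q) (f : ℂ → ℂ) :
    rho p q f = ENNReal.ofReal (1 / (2 * Real.pi)) ^ (1 / q) *
      (∫⁻ t in Set.Ico (0 : ℝ) (2 * Real.pi), radial p f t ^ q) ^ (1 / q) := by
  rw [rho, ENNReal.mul_rpow_of_nonneg _ _ (by positivity)]
  congr 3
  funext t
  rw [radial, ← ENNReal.rpow_mul, one_div_mul_eq_div]
  rfl

theorem radial_add_le {p : ℝ} (hp : 1 ≤ p) {f g : ℂ → ℂ} (hf : Measurable f) (hg : Measurable g)
    (t : ℝ) : radial p (f + g) t ≤ radial p f t + radial p g t := by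
  have hf' : Measurable (fun r : ℝ => ‖polarVal f t r‖ₑ) :=
    ((measurable_polarVal hf).comp measurable_prodMk_left).enorm
  have hg' : Measurable (fun r : ℝ => ‖polarVal g t r‖ₑ) :=
    ((measurable_polarVal hg).comp measurable_prodMk_left).enorm
  refine le_trans ?_ (ENNReal.lintegral_Lp_add_le hf'.aemeasurable hg'.aemeasurable hp)
  unfold radial
  gcongr
  exact enorm_add_le _ _

theorem rho_add_le {p q : ℝ} (hp : 1 ≤ p) (hq : 1 ≤ q) {f g : ℂ → ℂ} (hf : Measurable f)
    (hg : Measurable g) : rho p q (f + g) ≤ rho p q f + rho p q g := by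
  simp only [rho_eq p q hq]
  rw [← mul_add]
  gcongr
  refine le_trans ?_ (ENNReal.lintegral_Lp_add_le (measurable_radial p hf).aemeasurable
    (measurable_radial p hg).aemeasurable hq)
  gcongr with t
  exact radial_add_le hp hf hg t

theorem radial_smul {p : ℝ} (hp : 1 ≤ p) (c : ℂ) (f : ℂ → ℂ) (t : ℝ) :
    radial p (c • f) t = ‖c‖ₑ * radial p f t := by
  have h : ∀ r, ‖polarVal (c • f) t r‖ₑ ^ p = ‖c‖ₑ ^ p * ‖polarVal f t r‖ₑ ^ p := by
    intro r
    rw [← ENNReal.mul_rpow_of_nonneg _ _ (by positivity), ← enorm_mul]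
    rfl
  have hp0 : p ≠ 0 := by positivity
  simp only [radial, h]
  rw [lintegral_const_mul' _ _ (ENNReal.rpow_ne_top_of_nonneg (by positivity) enorm_ne_top),
    ENNReal.mul_rpow_of_nonneg _ _ (by positivity), ← ENNReal.rpow_mul, mul_one_div_cancel hp0,
    ENNReal.rpow_one]

theorem rho_smul {p q : ℝ} (hp : 1 ≤ p) (hq : 1 ≤ q) (c : ℂ) (f : ℂ → ℂ) :
    rho p q (c • f) = ‖c‖ₑ * rho p q f := by
  have hq0 : q ≠ 0 := by positivity
  simp only [rho_eq p q hq, radial_smul hp]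
  simp only [ENNReal.mul_rpow_of_nonneg _ _ (zero_le_one.trans hq)]
  rw [lintegral_const_mul' _ _ (ENNReal.rpow_ne_top_of_nonneg (by positivity) enorm_ne_top),
    ENNReal.mul_rpow_of_nonneg _ _ (by positivity), ← ENNReal.rpow_mul, mul_one_div_cancel hq0,
    ENNReal.rpow_one]
  ring

theorem rho_zero {p q : ℝ} (hp : 1 ≤ p) (hq : 1 ≤ q) : rho p q 0 = 0 := by
  have := rho_smul hp hq 0 0
  simpa using this

theorem eq_zero_of_rho_eq_zero {p q : ℝ} (hp : 1 ≤ p) (hq : 1 ≤ q) {f : ℂ → ℂ}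
    (hf : DifferentiableOn ℂ f (ball 0 1)) (h0 : ∀ z ∉ ball (0 : ℂ) 1, f z = 0)
    (h : rho p q f = 0) : f = 0 := by
  have hm := measurable_of_holo hf h0
  have hp' : 0 < p := by positivity
  have hq' : 0 < q := by positivity
  have hc : ENNReal.ofReal (1 / (2 * Real.pi)) ^ (1 / q) ≠ 0 := by
    rw [Ne, ENNReal.rpow_eq_zero_iff_of_pos (by positivity), ENNReal.ofReal_eq_zero, not_le]
    positivity
  rw [rho_eq p q hq, mul_eq_zero, or_iff_right hc,
    ENNReal.rpow_eq_zero_iff_of_pos (by positivity),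
    lintegral_eq_zero_iff ((measurable_radial p hm).pow_const q)] at h
  have : (ae (volume.restrict (Set.Ico (0 : ℝ) (2 * Real.pi)))).NeBot := by
    rw [ae_neBot, Ne, Measure.restrict_eq_zero, Real.volume_Ico]
    simp [Real.pi_pos]
  obtain ⟨t, ht⟩ := h.exists
  have hmt : Measurable (fun r : ℝ => ‖polarVal f t r‖ₑ) :=
    ((measurable_polarVal hm).comp measurable_prodMk_left).enorm
  simp only [Pi.zero_apply] at ht
  rw [ENNReal.rpow_eq_zero_iff_of_pos hq', radial, ENNReal.rpow_eq_zero_iff_of_pos (by positivity),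
    lintegral_eq_zero_iff (hmt.pow_const p)] at ht
  have hray : ∀ᵐ r ∂(volume.restrict (Set.Ico (0 : ℝ) 1)), polarVal f t r = 0 := by
    filter_upwards [ht] with r hr
    simpa [ENNReal.rpow_eq_zero_iff_of_pos hp'] using hr
  have hfreq : ∃ᶠ z in 𝓝[≠] (0 : ℂ), f z = 0 := by
    rw [frequently_iff]
    intro U hU
    obtain ⟨ε, hε, hεU⟩ := Metric.mem_nhdsWithin_iff.1 hU
    have hδ : 0 < min ε 1 := lt_min hε one_pos
    have hsub : Set.Ioo (0 : ℝ) (min ε 1) ⊆ Set.Ico 0 1 := fun r hr =>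
      ⟨hr.1.le, hr.2.trans_le (min_le_right _ _)⟩
    have hray' := ae_restrict_of_ae_restrict_of_subset hsub hray
    have : (ae (volume.restrict (Set.Ioo (0 : ℝ) (min ε 1)))).NeBot := by
      rw [ae_neBot, Ne, Measure.restrict_eq_zero, Real.volume_Ioo]
      simpa using hδ
    obtain ⟨r, hr, hr'⟩ := (hray'.and (ae_restrict_mem measurableSet_Ioo)).exists
    refine ⟨_, hεU ⟨?_, ?_⟩, hr⟩
    · rw [mem_ball_zero_iff, norm_mul, Complex.norm_exp_ofReal_mul_I, mul_one, Complex.norm_real,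
        Real.norm_of_nonneg hr'.1.le]
      exact hr'.2.trans_le (min_le_left _ _)
    · simp [hr'.1.ne']
  have han : AnalyticOnNhd ℂ f (ball 0 1) := hf.analyticOnNhd isOpen_ball
  have hz := han.eqOn_zero_of_preconnected_of_frequently_eq_zero
    (convex_ball (0 : ℂ) 1).isPreconnected (mem_ball_self one_pos) hfreq
  funext z
  by_cases hzb : z ∈ ball (0 : ℂ) 1
  · exact hz hzb
  · exact h0 z hzb

/-- `RM(p,q)` as a complex vector space of functions. -/
def rmSubmodule (p q : ℝ) [hp : Fact (1 ≤ p)] [hq : Fact (1 ≤ q)] : Submodule ℂ (ℂ → ℂ) where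
  carrier := rmSet p q
  add_mem' := by
    rintro f g ⟨hf, hf0, hf'⟩ ⟨hg, hg0, hg'⟩
    refine ⟨hf.add hg, fun z hz => by simp [hf0 z hz, hg0 z hz], ?_⟩
    exact (rho_add_le hp.out hq.out (measurable_of_holo hf hf0) (measurable_of_holo hg hg0)).trans_lt
      (ENNReal.add_lt_top.2 ⟨hf', hg'⟩)
  zero_mem' := by
    refine ⟨differentiableOn_const 0, fun z _ => rfl, ?_⟩
    rw [rho_zero hp.out hq.out]
    exact ENNReal.zero_lt_top
  smul_mem' := by
    rintro c f ⟨hf, hf0, hf'⟩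
    refine ⟨hf.const_smul c, fun z hz => by simp [hf0 z hz], ?_⟩
    rw [rho_smul hp.out hq.out]
    exact ENNReal.mul_lt_top enorm_lt_top hf'

/-- The average radial integrability space `RM(p,q)`, `1 ≤ p, q < ∞`. It is a type of its own so
that its topology is the one of the norm `ρ_{p,q}`, not that of pointwise convergence. -/
def RM (p q : ℝ) [Fact (1 ≤ p)] [Fact (1 ≤ q)] : Type := ↥(rmSubmodule p q)

namespace RM

variable {p q : ℝ} [hp : Fact (1 ≤ p)] [hq : Fact (1 ≤ q)]

instance : AddCommGroup (RM p q) := inferInstanceAs (AddCommGroup ↥(rmSubmodule p q))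

instance : Module ℂ (RM p q) := inferInstanceAs (Module ℂ ↥(rmSubmodule p q))

/-- The function underlying an element of `RM(p,q)`. -/
def toFun (f : RM p q) : ℂ → ℂ := f.1

instance : CoeFun (RM p q) (fun _ => ℂ → ℂ) := ⟨toFun⟩

theorem mem (f : RM p q) : (f : ℂ → ℂ) ∈ rmSet p q := f.2

/-- The norm of `RM(p,q)` is `ρ_{p,q}`. -/
instance : NormedAddCommGroup (RM p q) :=
  AddGroupNorm.toNormedAddCommGroup
    { toFun := fun f => (rho p q f).toReal
      map_zero' := by
        change (rho p q 0).toReal = 0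
        rw [rho_zero hp.out hq.out, ENNReal.toReal_zero]
      add_le' := by
        intro f g
        have hf := f.mem
        have hg := g.mem
        rw [← ENNReal.toReal_add hf.2.2.ne hg.2.2.ne]
        exact ENNReal.toReal_mono (ENNReal.add_lt_top.2 ⟨hf.2.2, hg.2.2⟩).ne
          (rho_add_le hp.out hq.out (measurable_of_holo hf.1 hf.2.1)
            (measurable_of_holo hg.1 hg.2.1))
      neg' := by
        intro f
        have h : ((-f : RM p q) : ℂ → ℂ) = (-1 : ℂ) • (f : ℂ → ℂ) := (neg_one_smul ℂ _).symm
        rw [h, rho_smul hp.out hq.out]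
        simp
      eq_zero_of_map_eq_zero' := by
        intro f h
        have hf := f.mem
        have h' : rho p q f = 0 := ((ENNReal.toReal_eq_zero_iff _).1 h).resolve_right hf.2.2.ne
        exact Subtype.ext (eq_zero_of_rho_eq_zero hp.out hq.out hf.1 hf.2.1 h') }

theorem norm_def (f : RM p q) : ‖f‖ = (rho p q f).toReal := rfl

instance : NormedSpace ℂ (RM p q) where
  norm_smul_le := by
    intro c f
    have h : ((c • f : RM p q) : ℂ → ℂ) = c • (f : ℂ → ℂ) := rfl
    rw [norm_def, norm_def, h, rho_smul hp.out hq.out, ENNReal.toReal_mul, toReal_enorm]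

end RM

instance fact_one_le_one_real : Fact ((1 : ℝ) ≤ 1) := ⟨le_refl 1⟩

/-- The Bloch space `𝓑`: holomorphic `g` on the unit disc with `sup (1 - |z|²) |g'(z)| < ∞`.
The values of `g` off the open unit disc play no role. -/
def blochSpace : Set (ℂ → ℂ) :=
  {g | DifferentiableOn ℂ g (ball 0 1) ∧
    ∃ C : ℝ, ∀ z ∈ ball (0 : ℂ) 1, (1 - ‖z‖ ^ 2) * ‖deriv g z‖ ≤ C}

/-- The little Bloch space `𝓑₀`: those `g ∈ 𝓑` with `(1 - |z|²) |g'(z)| → 0` as `|z| → 1⁻`. -/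
def littleBlochSpace : Set (ℂ → ℂ) :=
  {g | g ∈ blochSpace ∧
    Tendsto (fun z : ℂ => (1 - ‖z‖ ^ 2) * ‖deriv g z‖)
      (comap (fun z : ℂ => ‖z‖) (𝓝[<] 1)) (𝓝 0)}

/-- `T_g(f)(z) = ∫_0^z f(w) g'(w) dw`, the integral being taken along the segment `w = s z`,
`0 ≤ s ≤ 1`. -/
def integrationOperator (g f : ℂ → ℂ) (z : ℂ) : ℂ :=
  ∫ s in (0 : ℝ)..1, f ((s : ℂ) * z) * deriv g ((s : ℂ) * z) * z

/-- A bounded operator is weakly compact if it maps the closed unit ball onto a set whose closure in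
the weak topology is weakly compact. -/
def IsWeaklyCompactOperator {E F : Type*} [NormedAddCommGroup E] [NormedSpace ℂ E]
    [NormedAddCommGroup F] [NormedSpace ℂ F] (T : E →L[ℂ] F) : Prop :=
  IsCompact (closure ((fun x => toWeakSpace ℂ F (T x)) '' closedBall (0 : E) 1))

end

/-! On a fixed ray, `T_g f` at radius `r` is the integral of `f g'` along that same ray from the
origin, and the Bloch condition gives `|g'| ≤ C / (1 - s)` at radius `s`. Hardy's inequality
(`hardy`) therefore bounds the radial `L^p` norm of `T_g f` by `C p` times that of `f`, angle by
angle, and averaging over the angle shows that `T_g` is bounded.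

The same estimate with a split weight (`radial_integrationExt_le`) shows that a little Bloch symbol
gives a compact operator. Near the boundary `C` may be replaced by a small constant. On a smaller
disc, Cauchy estimates give functions of bounded norm a uniform Lipschitz bound, so finitely many
point values control them up to a small error. Hence the image of the unit ball is totally bounded,
and `RM(p,1)` is complete.

Compact operators are weakly compact. For the remaining implication, suppose `g ∉ 𝓑₀`, so that `(1 -
|a_n|²) |g'(a_n)| ≥ ε` for some `a_n → ζ` with `|ζ| = 1`. Peak functions at `a_n` lie in the unit
ball. By the derivative estimate at `a_n` their images under `T_g` have norms bounded below
(`le_norm_integrationCLM_peakRM`). The radial norms of these images are dominated by a multiple of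
`(1 - |a_n|) / |e^{it} - a_n|²`, essentially a Poisson kernel, so the images concentrate in angle at
`ζ`. A gliding hump extracts a subsequence carried, up to a small error, by disjoint sets of angles.
Because the outer exponent is `1`, its convex combinations stay away from zero, as for the basis of
`ℓ¹`, and Hahn–Banach yields a functional whose real part is bounded below by a positive constant on
the subsequence. But the images tend to zero pointwise, so `0` is their only possible weak cluster
point: a contradiction. -/

/-! ### Hardy's inequality on a ray -/

theorem lintegral_rpow_le_measure_univ_mul {α : Type*} [MeasurableSpace α] (μ : Measure α) {p : ℝ}
    (hp : 1 ≤ p) {k : α → ℝ≥0∞} (hk : AEMeasurable k μ) :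
    (∫⁻ x, k x ∂μ) ^ p ≤ μ Set.univ ^ (p - 1) * ∫⁻ x, k x ^ p ∂μ := by
  rcases hp.eq_or_lt with rfl | hp
  · simp
  have hpq := Real.HolderConjugate.conjExponent hp
  have hp0 : 0 < p := by linarith
  have h := ENNReal.lintegral_mul_le_Lp_mul_Lq μ hpq hk (aemeasurable_const (b := (1 : ℝ≥0∞)))
  simp only [Pi.mul_apply, mul_one, ENNReal.one_rpow, lintegral_one] at h
  have h' := ENNReal.rpow_le_rpow h hp0.le
  rw [ENNReal.mul_rpow_of_nonneg _ _ hp0.le, ← ENNReal.rpow_mul, ← ENNReal.rpow_mul,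
    one_div_mul_cancel hp0.ne', ENNReal.rpow_one, mul_comm] at h'
  refine h'.trans_eq ?_
  congr 2
  rw [Real.conjExponent]
  field_simp

theorem lintegral_Ioo_rpow_tail_le {x s : ℝ} (hx : 0 < x) (b : ℝ) (hs : 0 < s) :
    ∫⁻ y in Set.Ioo x b, ENNReal.ofReal (y ^ (-1 - s)) ≤ ENNReal.ofReal (x ^ (-s) / s) := by
  rcases le_or_gt b x with hb | hb
  · simp [Set.Ioo_eq_empty_of_le hb]
  have h0 : (0 : ℝ) ∉ Set.uIcc x b := by
    rw [Set.uIcc_of_le hb.le]; exact fun h => absurd h.1 (not_le.2 hx)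
  have hi : IntervalIntegrable (fun y : ℝ => y ^ (-1 - s)) volume x b :=
    intervalIntegral.intervalIntegrable_rpow (Or.inr h0)
  rw [← ofReal_integral_eq_lintegral_ofReal
    ((intervalIntegrable_iff_integrableOn_Ioo_of_le hb.le).1 hi)
    ((ae_restrict_mem measurableSet_Ioo).mono fun y hy => Real.rpow_nonneg (hx.trans hy.1).le _),
    ← integral_Ioc_eq_integral_Ioo, ← intervalIntegral.integral_of_le hb.le,
    integral_rpow (Or.inr ⟨by linarith, h0⟩)]
  apply ENNReal.ofReal_le_ofReal
  have : (b ^ (-1 - s + 1) - x ^ (-1 - s + 1)) / (-1 - s + 1) = (x ^ (-s) - b ^ (-s)) / s := by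
    rw [show -1 - s + 1 = -s by ring]; field_simp; ring
  rw [this]
  have := Real.rpow_nonneg (hx.trans hb).le (-s)
  gcongr
  linarith

theorem lintegral_Ioo_zero_rpow_sub_one {y s : ℝ} (hy : 0 ≤ y) (hs : 0 < s) :
    ∫⁻ x in Set.Ioo 0 y, ENNReal.ofReal (x ^ (s - 1)) = ENNReal.ofReal (y ^ s / s) := by
  have hi : IntervalIntegrable (fun y : ℝ => y ^ (s - 1)) volume 0 y :=
    intervalIntegral.intervalIntegrable_rpow' (by linarith)
  rw [← ofReal_integral_eq_lintegral_ofReal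
    ((intervalIntegrable_iff_integrableOn_Ioo_of_le hy).1 hi)
    ((ae_restrict_mem measurableSet_Ioo).mono fun y hy => Real.rpow_nonneg hy.1.le _),
    ← integral_Ioc_eq_integral_Ioo, ← intervalIntegral.integral_of_le hy,
    integral_rpow (Or.inl (by linarith))]
  simp [Real.zero_rpow hs.ne']

/-- Hölder against the weight `y^(-1 - 1/p)`, whose mass on `(x, 1)` is at most `p x^(-1/p)`, puts
the power `p` inside. After Tonelli, the integral of `x^(1/p - 1)` over `(0, y)` is `p y^(1/p)`,
which cancels the remaining power of `y`. The constants multiply to `p^(p-1) * p`. -/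
theorem hardy_Ioo {p : ℝ} (hp : 1 ≤ p) {h : ℝ → ℝ≥0∞} (hh : Measurable h) :
    ∫⁻ x in Set.Ioo (0 : ℝ) 1, (∫⁻ y in Set.Ioo x 1, h y / ENNReal.ofReal y) ^ p ≤
      ENNReal.ofReal p ^ p * ∫⁻ y in Set.Ioo (0 : ℝ) 1, h y ^ p := by
  have hp0 : 0 < p := by linarith
  have hs : 0 < 1 / p := by positivity
  have hm1 : Measurable fun y : ℝ => ENNReal.ofReal (y ^ (-1 - 1 / p)) := by fun_prop
  have hm2 : Measurable fun y : ℝ => h y * ENNReal.ofReal (y ^ (1 / p)) :=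
    hh.mul (by fun_prop)
  have inner : ∀ x ∈ Set.Ioo (0 : ℝ) 1, (∫⁻ y in Set.Ioo x 1, h y / ENNReal.ofReal y) ^ p ≤
      ∫⁻ y in Set.Ioo x 1, ENNReal.ofReal p ^ (p - 1) * ENNReal.ofReal (x ^ (1 / p - 1)) *
        (h y ^ p * ENNReal.ofReal (y ^ (-(1 / p)))) := by
    intro x hx
    -- The kernel splits as `1 / y = y^(1/p) * y^(-1 - 1/p)`: the first factor stays with `h`, the
    -- second becomes the measure.
    set μ := (volume.restrict (Set.Ioo x 1)).withDensity
      (fun y => ENNReal.ofReal (y ^ (-1 - 1 / p))) with hμ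
    have e1 : ∫⁻ y in Set.Ioo x 1, h y / ENNReal.ofReal y =
        ∫⁻ y, h y * ENNReal.ofReal (y ^ (1 / p)) ∂μ := by
      rw [hμ, lintegral_withDensity_eq_lintegral_mul _ hm1 hm2]
      refine setLIntegral_congr_fun measurableSet_Ioo fun y hy => ?_
      have hy0 : 0 < y := hx.1.trans hy.1
      simp only [Pi.mul_apply]
      rw [mul_left_comm, ← ENNReal.ofReal_mul (by positivity), ← Real.rpow_add hy0,
        div_eq_mul_inv, ← ENNReal.ofReal_inv_of_pos hy0, sub_add_cancel, Real.rpow_neg_one]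
    have e2 : ∫⁻ y, (h y * ENNReal.ofReal (y ^ (1 / p))) ^ p ∂μ =
        ∫⁻ y in Set.Ioo x 1, h y ^ p * ENNReal.ofReal (y ^ (-(1 / p))) := by
      rw [hμ, lintegral_withDensity_eq_lintegral_mul _ hm1 (hm2.pow_const p)]
      refine setLIntegral_congr_fun measurableSet_Ioo fun y hy => ?_
      have hy0 : 0 < y := hx.1.trans hy.1
      simp only [Pi.mul_apply]
      rw [ENNReal.mul_rpow_of_nonneg _ _ hp0.le, ENNReal.ofReal_rpow_of_pos (by positivity),
        ← Real.rpow_mul hy0.le, one_div_mul_cancel hp0.ne', mul_left_comm,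
        ← ENNReal.ofReal_mul (by positivity), ← Real.rpow_add hy0]
      congr 3; ring
    have e3 : μ Set.univ ≤ ENNReal.ofReal (x ^ (-(1 / p)) / (1 / p)) := by
      rw [hμ, withDensity_apply _ MeasurableSet.univ, Measure.restrict_univ]
      exact lintegral_Ioo_rpow_tail_le hx.1 1 hs
    rw [e1]
    refine (lintegral_rpow_le_measure_univ_mul μ hp hm2.aemeasurable).trans ?_
    rw [e2, lintegral_const_mul' _ _ (by finiteness)]
    gcongr
    refine (ENNReal.rpow_le_rpow e3 (by linarith)).trans_eq ?_
    rw [show x ^ (-(1 / p)) / (1 / p) = p * x ^ (-(1 / p)) by field_simp,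
      ENNReal.ofReal_mul hp0.le, ENNReal.mul_rpow_of_nonneg _ _ (by linarith),
      ENNReal.ofReal_rpow_of_pos (Real.rpow_pos_of_pos hx.1 _), ← Real.rpow_mul hx.1.le]
    congr 3
    field_simp
    ring
  -- The indicator moves the triangle `x < y < 1` into the integrand, so that Tonelli applies to
  -- integrals over fixed sets.
  set K : ℝ → ℝ → ℝ≥0∞ := fun x y => (Set.Ioo x 1).indicator (fun y =>
    ENNReal.ofReal p ^ (p - 1) * ENNReal.ofReal (x ^ (1 / p - 1)) *
        (h y ^ p * ENNReal.ofReal (y ^ (-(1 / p))))) y with hK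
  have hKm : Measurable (Function.uncurry K) := by
    have : Function.uncurry K = {z : ℝ × ℝ | z.1 < z.2 ∧ z.2 < 1}.indicator (fun z =>
        ENNReal.ofReal p ^ (p - 1) * ENNReal.ofReal (z.1 ^ (1 / p - 1)) *
        (h z.2 ^ p * ENNReal.ofReal (z.2 ^ (-(1 / p))))) := by
      ext ⟨x, y⟩
      simp only [Function.uncurry, hK, Set.indicator, Set.mem_Ioo, Set.mem_ofPred_eq]
    rw [this]
    refine Measurable.indicator ?_ ((measurableSet_lt measurable_fst measurable_snd).inter
      (measurableSet_lt measurable_snd measurable_const))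
    exact (Measurable.mul (by fun_prop) (by fun_prop)).mul
      (((hh.comp measurable_snd).pow_const p).mul (by fun_prop))
  calc _ ≤ ∫⁻ x in Set.Ioo (0 : ℝ) 1, ∫⁻ y, K x y := by
        refine setLIntegral_mono' measurableSet_Ioo fun x hx => ?_
        rw [hK, lintegral_indicator measurableSet_Ioo]
        exact inner x hx
    _ = ∫⁻ y, ∫⁻ x in Set.Ioo (0 : ℝ) 1, K x y := by
        rw [lintegral_lintegral_swap hKm.aemeasurable]
    _ ≤ ∫⁻ y in Set.Ioo (0 : ℝ) 1, ENNReal.ofReal p ^ p * h y ^ p := by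
        rw [← lintegral_indicator measurableSet_Ioo]
        refine lintegral_mono fun y => ?_
        by_cases hy : y ∈ Set.Ioo (0 : ℝ) 1
        · rw [Set.indicator_of_mem hy]
          have : ∀ x ∈ Set.Ioo (0 : ℝ) 1, K x y = (Set.Ioo 0 y).indicator (fun x =>
              (ENNReal.ofReal p ^ (p - 1) * (h y ^ p * ENNReal.ofReal (y ^ (-(1 / p))))) *
                ENNReal.ofReal (x ^ (1 / p - 1))) x := by
            intro x hx
            by_cases hxy : x < y
            · rw [hK, Set.indicator_of_mem (show x ∈ Set.Ioo 0 y from ⟨hx.1, hxy⟩)]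
              simp only
              rw [Set.indicator_of_mem (show y ∈ Set.Ioo x 1 from ⟨hxy, hy.2⟩)]
              ring
            · rw [hK, Set.indicator_of_notMem (fun h => hxy h.2)]
              simp only
              rw [Set.indicator_of_notMem (fun h => hxy h.1)]
          rw [setLIntegral_congr_fun measurableSet_Ioo this]
          refine (setLIntegral_le_lintegral _ _).trans ?_
          rw [lintegral_indicator measurableSet_Ioo, lintegral_const_mul _ (by fun_prop),
            lintegral_Ioo_zero_rpow_sub_one hy.1.le hs]
          apply le_of_eq
          have hyp := hy.1
          rw [show y ^ (1 / p) / (1 / p) = p * y ^ (1 / p) by field_simp,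
            ENNReal.ofReal_mul hp0.le]
          calc _ = ENNReal.ofReal p ^ (p - 1) * ENNReal.ofReal p * h y ^ p *
              (ENNReal.ofReal (y ^ (-(1 / p))) * ENNReal.ofReal (y ^ (1 / p))) := by ring
            _ = _ := by
              rw [← ENNReal.ofReal_mul (by positivity), ← Real.rpow_add hyp, neg_add_cancel,
                Real.rpow_zero, ENNReal.ofReal_one, mul_one]
              congr 1
              conv_lhs => enter [2]; rw [← ENNReal.rpow_one (ENNReal.ofReal p)]
              rw [← ENNReal.rpow_add _ _ (by simpa using hp0) (by finiteness), sub_add_cancel]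
        · rw [Set.indicator_of_notMem hy, nonpos_iff_eq_zero]
          rw [setLIntegral_eq_zero measurableSet_Ioo]
          intro x hx
          refine Set.indicator_of_notMem (fun h => hy ⟨hx.1.trans h.1, h.2⟩) _
    _ = _ := lintegral_const_mul' _ _ (by finiteness)

/-- The reflection `y = 1 - s` moves the singularity from the boundary of the disc to the origin and
reduces to `hardy_Ioo`. -/
theorem hardy {p : ℝ} (hp : 1 ≤ p) {h : ℝ → ℝ≥0∞} (hh : Measurable h) :
    ∫⁻ r in Set.Ico (0 : ℝ) 1, (∫⁻ s in Set.Ico (0 : ℝ) r, h s / ENNReal.ofReal (1 - s)) ^ p ≤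
      ENNReal.ofReal p ^ p * ∫⁻ r in Set.Ico (0 : ℝ) 1, h r ^ p := by
  have refl : ∀ (a b : ℝ) (k : ℝ → ℝ≥0∞),
      ∫⁻ s in Set.Ico a b, k s = ∫⁻ y in Set.Ioo (1 - b) (1 - a), k (1 - y) := by
    intro a b k
    rw [setLIntegral_congr Ico_ae_eq_Ioc, ← setLIntegral_congr Ioo_ae_eq_Ioc,
      ← lintegral_indicator measurableSet_Ioo, ← lintegral_indicator measurableSet_Ioo,
      ← lintegral_sub_left_eq_self _ 1]
    refine lintegral_congr fun y => ?_
    have : (1 - y ∈ Set.Ioo a b) ↔ y ∈ Set.Ioo (1 - b) (1 - a) := by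
      simp only [Set.mem_Ioo]; constructor <;> rintro ⟨_, _⟩ <;> constructor <;> linarith
    simp only [Set.indicator, this]
  have := hardy_Ioo hp (h := fun y => h (1 - y)) (by fun_prop)
  rw [refl 0 1, refl 0 1]
  simp only [refl 0, sub_self, sub_zero, sub_sub_cancel]
  exact this

/-- Pointwise Hardy domination along each ray is inherited by the radial norms. -/
theorem radial_le_of_enorm_le {p : ℝ} (hp : 1 ≤ p) {F f : ℂ → ℂ} (hf : Measurable f)
    (A ε : ℝ≥0∞) (hε : ε ≠ ∞) (t : ℝ)
    (h : ∀ r ∈ Set.Ico (0 : ℝ) 1, ‖polarVal F t r‖ₑ ≤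
      A + ε * ∫⁻ s in Set.Ico (0 : ℝ) r, ‖polarVal f t s‖ₑ / ENNReal.ofReal (1 - s)) :
    radial p F t ≤ A + ε * (ENNReal.ofReal p * radial p f t) := by
  have hp0 : 0 < p := by linarith
  have hf' : Measurable (fun r : ℝ => ‖polarVal f t r‖ₑ) :=
    ((measurable_polarVal hf).comp measurable_prodMk_left).enorm
  set H : ℝ → ℝ≥0∞ :=
    fun r => ∫⁻ s in Set.Ico (0 : ℝ) r, ‖polarVal f t s‖ₑ / ENNReal.ofReal (1 - s) with hH
  have hHm : Measurable H := by
    refine Monotone.measurable fun a b hab => ?_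
    exact lintegral_mono_set (Set.Ico_subset_Ico_right hab)
  calc radial p F t ≤ (∫⁻ r in Set.Ico (0 : ℝ) 1, ((fun _ => A) + fun r => ε * H r : ℝ → ℝ≥0∞) r ^ p) ^
        (1 / p) := by
        unfold radial
        gcongr ?_ ^ _
        refine setLIntegral_mono' measurableSet_Ico fun r hr => ?_
        gcongr
        exact h r hr
    _ ≤ _ := ENNReal.lintegral_Lp_add_le aemeasurable_const (hHm.const_mul ε).aemeasurable hp
    _ ≤ A + ε * (ENNReal.ofReal p * radial p f t) := by
        gcongr
        · simp only [lintegral_const, Measure.restrict_apply MeasurableSet.univ, Set.univ_inter,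
            Real.volume_Ico, sub_zero, ENNReal.ofReal_one, mul_one]
          rw [← ENNReal.rpow_mul, mul_one_div_cancel hp0.ne', ENNReal.rpow_one]
        · simp only [ENNReal.mul_rpow_of_nonneg _ _ hp0.le]
          rw [lintegral_const_mul' _ _ (by finiteness)]
          calc _ ≤ (ε ^ p * (ENNReal.ofReal p ^ p *
                ∫⁻ r in Set.Ico (0 : ℝ) 1, ‖polarVal f t r‖ₑ ^ p)) ^ (1 / p) := by
                gcongr
                exact hardy hp hf'
            _ = _ := by
                rw [ENNReal.mul_rpow_of_nonneg _ _ (by positivity),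
                  ENNReal.mul_rpow_of_nonneg _ _ (by positivity), ← ENNReal.rpow_mul,
                  ← ENNReal.rpow_mul, mul_one_div_cancel hp0.ne', ENNReal.rpow_one,
                  ENNReal.rpow_one, radial]

/-! ### Interior estimates for values and derivatives -/

/-- Reconciles the angular range of polar coordinates with the one used in `rho`. -/
theorem setLIntegral_Ioo_neg_pi_pi_of_periodic {ψ : ℝ → ℝ≥0∞}
    (hψ : Function.Periodic ψ (2 * Real.pi)) :
    ∫⁻ t in Set.Ioo (-Real.pi) Real.pi, ψ t = ∫⁻ t in Set.Ico (0 : ℝ) (2 * Real.pi), ψ t := by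
  have : Fact (0 < 2 * Real.pi) := ⟨Real.two_pi_pos⟩
  rw [setLIntegral_congr Ioo_ae_eq_Ioc, setLIntegral_congr Ico_ae_eq_Ioc]
  have h1 := AddCircle.lintegral_preimage (2 * Real.pi) (-Real.pi) hψ.lift
  have h2 := AddCircle.lintegral_preimage (2 * Real.pi) 0 hψ.lift
  simp only [Function.Periodic.lift_coe] at h1 h2
  rw [show -Real.pi + 2 * Real.pi = Real.pi by ring] at h1
  rw [zero_add] at h2
  rw [h1, h2]

theorem polarVal_periodic (f : ℂ → ℂ) (r : ℝ) :
    Function.Periodic (fun t => polarVal f t r) (2 * Real.pi) := by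
  intro t
  simp only [polarVal]
  congr 2
  push_cast
  rw [add_mul, Complex.exp_add, Complex.exp_two_pi_mul_I, mul_one]

theorem radial_periodic (p : ℝ) (f : ℂ → ℂ) : Function.Periodic (radial p f) (2 * Real.pi) := by
  intro t
  unfold radial
  congr 1
  refine lintegral_congr fun r => ?_
  rw [show polarVal f (t + 2 * Real.pi) r = polarVal f t r from polarVal_periodic f r t]

/-- Cauchy's formula for the derivative on the circle of radius `s`; the factor `1 / (2π)` is merely
bounded by `1`. -/
theorem enorm_deriv_mul_le_lintegral_circle {f : ℂ → ℂ} {a : ℂ} {s : ℝ} (hs : 0 < s) {U : Set ℂ}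
    (hU : IsOpen U) (hsU : closedBall a s ⊆ U) (hf : DifferentiableOn ℂ f U) :
    ‖deriv f a‖ₑ * ENNReal.ofReal s ≤
      ∫⁻ t in Set.Ioo (-Real.pi) Real.pi, ‖polarVal (fun z => f (a + z)) t s‖ₑ := by
  rw [setLIntegral_Ioo_neg_pi_pi_of_periodic (ψ := fun t => ‖polarVal (fun z => f (a + z)) t s‖ₑ)
    (fun t => by simp only [polarVal_periodic (fun z => f (a + z)) s t])]
  set J : ℝ≥0∞ := ∫⁻ t in Set.Ico (0 : ℝ) (2 * Real.pi), ‖polarVal (fun z => f (a + z)) t s‖ₑ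
  have h := Complex.two_pi_I_inv_smul_circleIntegral_sub_sq_inv_smul_of_differentiable hU hsU hf
    (mem_ball_self hs)
  have h1 : deriv f a = (2 * Real.pi : ℂ)⁻¹ * ∫ t in (0 : ℝ)..2 * Real.pi,
      (s : ℂ)⁻¹ * Complex.exp (-(t * Complex.I)) * polarVal (fun z => f (a + z)) t s := by
    rw [← h, circleIntegral]
    simp only [smul_eq_mul, deriv_circleMap, circleMap, zero_add, add_sub_cancel_left, polarVal]
    rw [mul_inv, mul_assoc, ← intervalIntegral.integral_const_mul]
    congr 1
    refine intervalIntegral.integral_congr fun t _ => ?_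
    have hs' : (s : ℂ) ≠ 0 := by exact_mod_cast hs.ne'
    have he := Complex.exp_ne_zero (t * Complex.I)
    rw [Complex.exp_neg]
    field_simp
  rw [h1, enorm_mul]
  have h2 : ‖∫ t in (0 : ℝ)..2 * Real.pi,
      (s : ℂ)⁻¹ * Complex.exp (-(t * Complex.I)) * polarVal (fun z => f (a + z)) t s‖ₑ ≤
      ENNReal.ofReal s⁻¹ * J := by
    rw [intervalIntegral.integral_of_le Real.two_pi_pos.le,
      setIntegral_congr_set Ico_ae_eq_Ioc.symm]
    refine (enorm_integral_le_lintegral_enorm _).trans_eq ?_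
    rw [← lintegral_const_mul' _ _ (by finiteness)]
    refine lintegral_congr fun t => ?_
    rw [enorm_mul, enorm_mul]
    congr 1
    rw [← ofReal_norm, ← ofReal_norm, ← neg_mul, ← Complex.ofReal_neg,
      Complex.norm_exp_ofReal_mul_I]
    simp [abs_of_pos hs]
  have h3 : ‖(2 * Real.pi : ℂ)⁻¹‖ₑ ≤ 1 := by
    rw [← ofReal_norm, ← ENNReal.ofReal_one]
    apply ENNReal.ofReal_le_ofReal
    rw [norm_inv, norm_mul]
    simp only [Complex.norm_ofNat, Complex.norm_real, Real.norm_eq_abs, abs_of_pos Real.pi_pos]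
    apply inv_le_one_of_one_le₀
    nlinarith [Real.pi_gt_three]
  calc _ ≤ 1 * (ENNReal.ofReal s⁻¹ * J) * ENNReal.ofReal s := by gcongr
    _ = J * (ENNReal.ofReal s⁻¹ * ENNReal.ofReal s) := by ring
    _ = J := by
      rw [← ENNReal.ofReal_mul (by positivity), inv_mul_cancel₀ hs.ne', ENNReal.ofReal_one, mul_one]

theorem polarCoord_symm_eq (r t : ℝ) :
    Complex.polarCoord.symm (r, t) = (r : ℂ) * Complex.exp ((t : ℂ) * Complex.I) := by
  rw [Complex.polarCoord_symm_apply, Complex.exp_mul_I, Complex.ofReal_cos, Complex.ofReal_sin]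

theorem norm_mul_exp_mul_I {r : ℝ} (hr : 0 ≤ r) (t : ℝ) :
    ‖(r : ℂ) * Complex.exp ((t : ℂ) * Complex.I)‖ = r := by
  rw [norm_mul, Complex.norm_exp_ofReal_mul_I, mul_one, Complex.norm_real, Real.norm_of_nonneg hr]

/-- The circle estimate is integrated in polar coordinates about `a` over radii in `(R/2, R)`. There
the weight is at least `s² ≥ R²/4`, on an interval of length `R/2`, which gives `R³/8`. -/
theorem enorm_deriv_mul_le_lintegral_ball {f : ℂ → ℂ} (hm : Measurable f) {a : ℂ} {R : ℝ}
    (hR : 0 < R) (hf : DifferentiableOn ℂ f (ball a R)) :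
    ‖deriv f a‖ₑ * ENNReal.ofReal (R ^ 3 / 8) ≤ ∫⁻ z in ball a R, ‖f z‖ₑ := by
  set G : ℂ → ℝ≥0∞ := fun z => (ball (0 : ℂ) R).indicator (fun z => ‖f (a + z)‖ₑ) z with hG
  have hGm : Measurable G := (hm.comp (measurable_const_add a)).enorm.indicator measurableSet_ball
  have e1 : ∫⁻ z in ball a R, ‖f z‖ₑ = ∫⁻ z, G z := by
    rw [← lintegral_indicator measurableSet_ball, ← lintegral_add_left_eq_self _ a]
    refine lintegral_congr fun z => ?_
    simp [hG, Set.indicator]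
  rw [e1, ← Complex.lintegral_comp_polarCoord_symm, polarCoord_target, Measure.volume_eq_prod,
    ← Measure.prod_restrict, lintegral_prod]
  swap
  · refine Measurable.aemeasurable ?_
    simp only [Complex.polarCoord_symm_apply, smul_eq_mul]
    refine Measurable.mul (by fun_prop) (hGm.comp ?_)
    fun_prop
  calc ‖deriv f a‖ₑ * ENNReal.ofReal (R ^ 3 / 8)
      = ∫⁻ s in Set.Ioo (R / 2) R, ‖deriv f a‖ₑ * ENNReal.ofReal (R ^ 2 / 4) := by
        rw [setLIntegral_const, Real.volume_Ioo, mul_assoc, ← ENNReal.ofReal_mul (by positivity)]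
        congr 2; ring
    _ ≤ ∫⁻ s in Set.Ioo (R / 2) R, ∫⁻ t in Set.Ioo (-Real.pi) Real.pi,
          ENNReal.ofReal s • G (Complex.polarCoord.symm (s, t)) := by
        refine setLIntegral_mono' measurableSet_Ioo fun s hs => ?_
        have hs0 : 0 < s := by linarith [hs.1]
        simp only [smul_eq_mul]
        rw [lintegral_const_mul' _ _ (by finiteness)]
        have := enorm_deriv_mul_le_lintegral_circle hs0 isOpen_ball
          (closedBall_subset_ball hs.2) hf
        calc _ ≤ ENNReal.ofReal s * (‖deriv f a‖ₑ * ENNReal.ofReal s) := by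
              rw [mul_left_comm, ← ENNReal.ofReal_mul hs0.le]
              gcongr
              nlinarith [hs.1]
          _ ≤ _ := by
              gcongr
              refine this.trans_eq (lintegral_congr fun t => ?_)
              rw [polarCoord_symm_eq, hG]
              simp only
              rw [Set.indicator_of_mem]
              · rfl
              · rw [mem_ball_zero_iff, norm_mul_exp_mul_I hs0.le]; exact hs.2
    _ ≤ _ := lintegral_mono_set fun s hs => by
        have := hs.1
        simp only [Set.mem_Ioi]; linarith

theorem setLIntegral_polarVal_le {p : ℝ} (hp : 1 ≤ p) {f : ℂ → ℂ} (hm : Measurable f) (t : ℝ)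
    {I : Set ℝ} (hI : I ⊆ Set.Ico 0 1) {δ : ℝ} (hδ : 0 < δ)
    (hIδ : volume I ≤ ENNReal.ofReal δ) :
    ∫⁻ r in I, ‖polarVal f t r‖ₑ ≤ ENNReal.ofReal (δ ^ (1 - 1 / p)) * radial p f t := by
  have hp0 : 0 < p := by linarith
  have hf' : Measurable (fun r : ℝ => ‖polarVal f t r‖ₑ) :=
    ((measurable_polarVal hm).comp measurable_prodMk_left).enorm
  have h := lintegral_rpow_le_measure_univ_mul (volume.restrict I) hp hf'.aemeasurable
  rw [Measure.restrict_apply_univ] at h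
  have h' := ENNReal.rpow_le_rpow h (z := 1 / p) (by positivity)
  rw [← ENNReal.rpow_mul, mul_one_div_cancel hp0.ne', ENNReal.rpow_one,
    ENNReal.mul_rpow_of_nonneg _ _ (by positivity), ← ENNReal.rpow_mul] at h'
  refine h'.trans ?_
  rw [← ENNReal.ofReal_rpow_of_pos hδ, show (p - 1) * (1 / p) = 1 - 1 / p by field_simp]
  have : 0 ≤ 1 - 1 / p := by
    rw [sub_nonneg, div_le_one hp0]; exact hp
  unfold radial
  gcongr

/-- With `δ = 1 - |a|`, the disc of radius `δ/2` about `a` lies in an annulus that every ray from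
the origin meets in length at most `δ`. Hölder on each ray gives the factor `δ^(1 - 1/p)`; dividing
it by the `δ³/64` of the area estimate produces the exponent `2 + 1/p` and the constant `64`. -/
theorem enorm_deriv_mul_le {p : ℝ} (hp : 1 ≤ p) {f : ℂ → ℂ} (hm : Measurable f)
    (hf : DifferentiableOn ℂ f (ball 0 1)) {a : ℂ} (ha : a ∈ ball (0 : ℂ) 1) :
    ‖deriv f a‖ₑ * ENNReal.ofReal ((1 - ‖a‖) ^ (2 + 1 / p)) ≤
      64 * ∫⁻ t in Set.Ico (0 : ℝ) (2 * Real.pi), radial p f t := by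
  rw [mem_ball_zero_iff] at ha
  set δ := 1 - ‖a‖ with hδ
  have hδ0 : 0 < δ := by linarith
  have hsub : ball a (δ / 2) ⊆ ball 0 1 := by
    apply ball_subset_ball'
    rw [dist_zero_right]; linarith
  have h1 := enorm_deriv_mul_le_lintegral_ball hm (half_pos hδ0) (hf.mono hsub)
  set I : Set ℝ := Set.Ioo (‖a‖ - δ / 2) (‖a‖ + δ / 2) ∩ Set.Ico 0 1 with hI
  have hIm : MeasurableSet I := measurableSet_Ioo.inter measurableSet_Ico
  have h2 : ∫⁻ z in ball a (δ / 2), ‖f z‖ₑ ≤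
      ∫⁻ t in Set.Ico (0 : ℝ) (2 * Real.pi), ENNReal.ofReal (δ ^ (1 - 1 / p)) * radial p f t := by
    rw [← lintegral_indicator measurableSet_ball, ← Complex.lintegral_comp_polarCoord_symm,
      polarCoord_target, Measure.volume_eq_prod, ← Measure.prod_restrict, lintegral_prod_symm]
    swap
    · refine Measurable.aemeasurable ?_
      simp only [Complex.polarCoord_symm_apply, smul_eq_mul]
      refine Measurable.mul (by fun_prop) ((hm.enorm.indicator measurableSet_ball).comp ?_)
      fun_prop
    rw [← setLIntegral_Ioo_neg_pi_pi_of_periodic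
      (fun t => by simp only [radial_periodic p f t])]
    refine lintegral_mono fun t => ?_
    refine le_trans ?_ (setLIntegral_polarVal_le hp hm t (I := I) Set.inter_subset_right hδ0 ?_)
    · rw [← lintegral_indicator hIm]
      refine (setLIntegral_mono' measurableSet_Ioi (fun r hr => ?_)).trans
        (setLIntegral_le_lintegral (Set.Ioi 0) _)
      have hr0 : (0 : ℝ) ≤ r := le_of_lt hr
      simp only [polarCoord_symm_eq, smul_eq_mul]
      by_cases hb : (r : ℂ) * Complex.exp ((t : ℂ) * Complex.I) ∈ ball a (δ / 2)
      · have hn := norm_mul_exp_mul_I hr0 t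
        rw [mem_ball_iff_norm] at hb
        have := abs_norm_sub_norm_le ((r : ℂ) * Complex.exp ((t : ℂ) * Complex.I)) a
        rw [hn] at this
        have h3 := abs_lt.1 (this.trans_lt hb)
        rw [Set.indicator_of_mem (by rwa [mem_ball_iff_norm]),
          Set.indicator_of_mem (show r ∈ I from
            ⟨⟨by linarith, by linarith⟩, hr0, by linarith⟩)]
        calc _ ≤ 1 * ‖f ((r : ℂ) * Complex.exp ((t : ℂ) * Complex.I))‖ₑ := by
              gcongr
              rw [← ENNReal.ofReal_one]
              apply ENNReal.ofReal_le_ofReal; linarith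
          _ = _ := one_mul _
      · rw [Set.indicator_of_notMem hb, mul_zero]
        exact zero_le
    · refine (measure_mono Set.inter_subset_left).trans_eq ?_
      rw [Real.volume_Ioo]
      congr 1; ring
  rw [lintegral_const_mul' _ _ (by finiteness)] at h2
  set J := ∫⁻ t in Set.Ico (0 : ℝ) (2 * Real.pi), radial p f t
  have h3 := h1.trans h2
  have hpow : 0 < δ ^ (-(1 - 1 / p)) := by positivity
  calc ‖deriv f a‖ₑ * ENNReal.ofReal (δ ^ (2 + 1 / p))
      = 64 * ENNReal.ofReal (δ ^ (-(1 - 1 / p))) *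
          (‖deriv f a‖ₑ * ENNReal.ofReal ((δ / 2) ^ 3 / 8)) := by
        have : δ ^ (2 + 1 / p) = 64 * δ ^ (-(1 - 1 / p)) * ((δ / 2) ^ 3 / 8) := by
          rw [show (2 + 1 / p) = -(1 - 1 / p) + 3 by ring, Real.rpow_add hδ0]
          norm_cast
          ring
        rw [this, ENNReal.ofReal_mul (by positivity), ENNReal.ofReal_mul (by positivity)]
        rw [show ENNReal.ofReal 64 = 64 by norm_num]
        ring
    _ ≤ 64 * ENNReal.ofReal (δ ^ (-(1 - 1 / p))) * (ENNReal.ofReal (δ ^ (1 - 1 / p)) * J) := by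
        gcongr
    _ = 64 * (ENNReal.ofReal (δ ^ (-(1 - 1 / p))) * ENNReal.ofReal (δ ^ (1 - 1 / p))) * J := by
        ring
    _ = 64 * J := by
        rw [← ENNReal.ofReal_mul hpow.le, ← Real.rpow_add hδ0, neg_add_cancel, Real.rpow_zero,
          ENNReal.ofReal_one, mul_one]

theorem radial_mul_le_of_norm_le {p : ℝ} (hp : 1 ≤ p) {f u : ℂ → ℂ} {C : ℝ≥0∞} (hC : C ≠ ∞)
    (hu : ∀ z ∈ ball (0 : ℂ) 1, ‖u z‖ₑ ≤ C) (t : ℝ) :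
    radial p (fun z => u z * f z) t ≤ C * radial p f t := by
  have hp0 : 0 < p := by linarith
  unfold radial
  calc _ ≤ (∫⁻ r in Set.Ico (0 : ℝ) 1, C ^ p * ‖polarVal f t r‖ₑ ^ p) ^ (1 / p) := by
        gcongr ?_ ^ _
        refine setLIntegral_mono' measurableSet_Ico fun r hr => ?_
        rw [← ENNReal.mul_rpow_of_nonneg _ _ hp0.le]
        gcongr
        simp only [polarVal, enorm_mul]
        gcongr
        apply hu
        rw [mem_ball_zero_iff, norm_mul_exp_mul_I hr.1]
        exact hr.2
    _ = _ := by
        rw [lintegral_const_mul' _ _ (by finiteness), ENNReal.mul_rpow_of_nonneg _ _ (by positivity),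
          ← ENNReal.rpow_mul, mul_one_div_cancel hp0.ne', ENNReal.rpow_one]

/-- The derivative of `(z - a) f(z)` at `a` is `f(a)`, so the derivative estimate also bounds
values; `|z - a| ≤ 2` doubles the constant. -/
theorem enorm_mul_le {p : ℝ} (hp : 1 ≤ p) {f : ℂ → ℂ} (hm : Measurable f)
    (hf : DifferentiableOn ℂ f (ball 0 1)) {a : ℂ} (ha : a ∈ ball (0 : ℂ) 1) :
    ‖f a‖ₑ * ENNReal.ofReal ((1 - ‖a‖) ^ (2 + 1 / p)) ≤
      128 * ∫⁻ t in Set.Ico (0 : ℝ) (2 * Real.pi), radial p f t := by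
  have hd : deriv (fun z => (z - a) * f z) a = f a := by
    have h1 : HasDerivAt (fun z : ℂ => z - a) 1 a := (hasDerivAt_id a).sub_const a
    have h2 := (hf.differentiableAt (isOpen_ball.mem_nhds ha)).hasDerivAt
    simpa using (HasDerivAt.fun_mul h1 h2).deriv
  have h := enorm_deriv_mul_le hp (f := fun z => (z - a) * f z) (by fun_prop)
    ((by fun_prop : DifferentiableOn ℂ (fun z : ℂ => z - a) (ball 0 1)).mul hf) ha
  rw [hd] at h
  refine h.trans ?_
  calc _ ≤ 64 * ∫⁻ t in Set.Ico (0 : ℝ) (2 * Real.pi), 2 * radial p f t := by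
        gcongr with t
        refine radial_mul_le_of_norm_le hp (by finiteness) (fun z hz => ?_) t
        rw [mem_ball_zero_iff] at hz ha
        rw [← ofReal_norm, show (2 : ℝ≥0∞) = ENNReal.ofReal 2 by norm_num]
        apply ENNReal.ofReal_le_ofReal
        linarith [norm_sub_le z a]
    _ = _ := by
        rw [lintegral_const_mul' _ _ (by finiteness), ← mul_assoc]
        norm_num

/-! ### Fatou's lemma and completeness of `RM(p,1)` -/

theorem rho_one_eq (p : ℝ) (f : ℂ → ℂ) :
    rho p 1 f = ENNReal.ofReal (1 / (2 * Real.pi)) *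
      ∫⁻ t in Set.Ico (0 : ℝ) (2 * Real.pi), radial p f t := by
  rw [rho_eq p 1 le_rfl]
  simp

theorem lintegral_radial_eq (p : ℝ) (f : ℂ → ℂ) :
    ∫⁻ t in Set.Ico (0 : ℝ) (2 * Real.pi), radial p f t =
      ENNReal.ofReal (2 * Real.pi) * rho p 1 f := by
  rw [rho_one_eq, ← mul_assoc, ← ENNReal.ofReal_mul (by positivity),
    mul_one_div_cancel (by positivity), ENNReal.ofReal_one, one_mul]

theorem radial_le_of_tendsto {p : ℝ} (hp : 1 ≤ p) {u : ℕ → ℂ → ℂ} {F : ℂ → ℂ}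
    (hu : ∀ n, Measurable (u n)) (hF : ∀ z, Tendsto (fun n => u n z) atTop (𝓝 (F z))) (t : ℝ) :
    radial p F t ≤ liminf (fun n => radial p (u n) t) atTop := by
  have hp0 : 0 < p := by linarith
  have hm : ∀ n, Measurable (fun r : ℝ => ‖polarVal (u n) t r‖ₑ ^ p) := fun n =>
    ((measurable_polarVal (hu n)).comp measurable_prodMk_left).enorm.pow_const p
  have h1 : ∫⁻ r in Set.Ico (0 : ℝ) 1, ‖polarVal F t r‖ₑ ^ p ≤
      liminf (fun n => ∫⁻ r in Set.Ico (0 : ℝ) 1, ‖polarVal (u n) t r‖ₑ ^ p) atTop := by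
    refine le_trans (lintegral_mono fun r => ?_) (lintegral_liminf_le hm)
    refine (Tendsto.liminf_eq ?_).ge
    exact ((ENNReal.continuous_rpow_const (y := p)).tendsto _).comp (hF _).enorm
  have h2 := ENNReal.rpow_le_rpow h1 (z := 1 / p) (by positivity)
  refine h2.trans_eq ?_
  have := (ENNReal.orderIsoRpow (1 / p) (by positivity)).liminf_apply
    (f := atTop) (u := fun n => ∫⁻ r in Set.Ico (0 : ℝ) 1, ‖polarVal (u n) t r‖ₑ ^ p)
  exact this

/-- Fatou's lemma twice, along the rays and then in the angle: the norm is lower semicontinuous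
under pointwise convergence. -/
theorem rho_le_of_tendsto {p : ℝ} (hp : 1 ≤ p) {u : ℕ → ℂ → ℂ} {F : ℂ → ℂ}
    (hu : ∀ n, Measurable (u n)) (hF : ∀ z, Tendsto (fun n => u n z) atTop (𝓝 (F z)))
    {C : ℝ≥0∞} (hC : ∀ᶠ n in atTop, rho p 1 (u n) ≤ C) : rho p 1 F ≤ C := by
  rw [rho_one_eq]
  have h1 : ∫⁻ t in Set.Ico (0 : ℝ) (2 * Real.pi), radial p F t ≤
      liminf (fun n => ∫⁻ t in Set.Ico (0 : ℝ) (2 * Real.pi), radial p (u n) t) atTop :=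
    (lintegral_mono fun t => radial_le_of_tendsto hp hu hF t).trans
      (lintegral_liminf_le fun n => measurable_radial p (hu n))
  calc _ ≤ ENNReal.ofReal (1 / (2 * Real.pi)) * (ENNReal.ofReal (2 * Real.pi) * C) := by
        gcongr
        refine h1.trans ?_
        refine liminf_le_of_frequently_le' (hC.mono fun n hn => ?_).frequently
        rw [lintegral_radial_eq]
        gcongr
    _ = C := by
        rw [← mul_assoc, ← ENNReal.ofReal_mul (by positivity), one_div_mul_cancel (by positivity),
          ENNReal.ofReal_one, one_mul]

namespace RM

variable {p : ℝ} [hp : Fact (1 ≤ p)]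

/-- The element of `RM(p,1)` with a given underlying function. -/
def ofMem (F : ℂ → ℂ) (hF : F ∈ rmSet p 1) : RM p 1 := ⟨F, hF⟩

theorem differentiableOn (f : RM p 1) : DifferentiableOn ℂ f (ball 0 1) := f.mem.1

theorem apply_eq_zero (f : RM p 1) {z : ℂ} (hz : z ∉ ball (0 : ℂ) 1) : f z = 0 := f.mem.2.1 z hz

theorem measurable (f : RM p 1) : Measurable f := measurable_of_holo f.mem.1 f.mem.2.1

theorem ext {f g : RM p 1} (h : ∀ z ∈ ball (0 : ℂ) 1, f z = g z) : f = g := by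
  refine Subtype.ext (funext fun z => ?_)
  by_cases hz : z ∈ ball (0 : ℂ) 1
  · exact h z hz
  · exact (f.apply_eq_zero hz).trans (g.apply_eq_zero hz).symm

theorem add_apply (f g : RM p 1) (z : ℂ) : (f + g) z = f z + g z := rfl

theorem sub_apply (f g : RM p 1) (z : ℂ) : (f - g) z = f z - g z := rfl

theorem smul_apply (c : ℂ) (f : RM p 1) (z : ℂ) : (c • f) z = c * f z := rfl

theorem rho_eq_ofReal_norm (f : RM p 1) : rho p 1 f = ENNReal.ofReal ‖f‖ := by
  rw [norm_def, ENNReal.ofReal_toReal f.mem.2.2.ne]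

theorem norm_deriv_mul_le (f : RM p 1) {a : ℂ} (ha : a ∈ ball (0 : ℂ) 1) :
    ‖deriv f a‖ * (1 - ‖a‖) ^ (2 + 1 / p) ≤ 128 * Real.pi * ‖f‖ := by
  have h := enorm_deriv_mul_le hp.out f.measurable f.differentiableOn ha
  rw [mem_ball_zero_iff] at ha
  have h0 : 0 ≤ (1 - ‖a‖) ^ (2 + 1 / p) := Real.rpow_nonneg (by linarith) _
  rw [lintegral_radial_eq, rho_eq_ofReal_norm, ← ofReal_norm, ← ENNReal.ofReal_mul (by positivity),
    ← ENNReal.ofReal_mul (by positivity), show (64 : ℝ≥0∞) = ENNReal.ofReal 64 by norm_num,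
    ← ENNReal.ofReal_mul (by positivity), ENNReal.ofReal_le_ofReal_iff (by positivity)] at h
  linarith

theorem norm_apply_mul_le (f : RM p 1) {a : ℂ} (ha : a ∈ ball (0 : ℂ) 1) :
    ‖f a‖ * (1 - ‖a‖) ^ (2 + 1 / p) ≤ 256 * Real.pi * ‖f‖ := by
  have h := enorm_mul_le hp.out f.measurable f.differentiableOn ha
  rw [mem_ball_zero_iff] at ha
  have h0 : 0 ≤ (1 - ‖a‖) ^ (2 + 1 / p) := Real.rpow_nonneg (by linarith) _
  rw [lintegral_radial_eq, rho_eq_ofReal_norm, ← ofReal_norm, ← ENNReal.ofReal_mul (by positivity),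
    ← ENNReal.ofReal_mul (by positivity), show (128 : ℝ≥0∞) = ENNReal.ofReal 128 by norm_num,
    ← ENNReal.ofReal_mul (by positivity), ENNReal.ofReal_le_ofReal_iff (by positivity)] at h
  linarith

theorem norm_apply_le (f : RM p 1) {R : ℝ} (hR : R < 1) {a : ℂ} (ha : ‖a‖ ≤ R) :
    ‖f a‖ ≤ 256 * Real.pi / (1 - R) ^ (2 + 1 / p) * ‖f‖ := by
  have hp0 : 0 < p := by linarith [hp.out]
  have h := f.norm_apply_mul_le (mem_ball_zero_iff.2 (ha.trans_lt hR))
  have h0 : 0 < (1 - R) ^ (2 + 1 / p) := Real.rpow_pos_of_pos (by linarith) _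
  have h1 : (1 - R) ^ (2 + 1 / p) ≤ (1 - ‖a‖) ^ (2 + 1 / p) :=
    Real.rpow_le_rpow (by linarith) (by linarith) (by positivity)
  rw [div_mul_eq_mul_div, le_div_iff₀ h0]
  exact (mul_le_mul_of_nonneg_left h1 (norm_nonneg _)).trans h

/-- This equicontinuity on smaller discs lets finitely many evaluations control a function there in
the compactness proof. -/
theorem norm_sub_apply_le (f : RM p 1) {R : ℝ} (hR : R < 1) {a b : ℂ} (ha : ‖a‖ ≤ R)
    (hb : ‖b‖ ≤ R) :
    ‖f a - f b‖ ≤ 128 * Real.pi / (1 - R) ^ (2 + 1 / p) * ‖f‖ * ‖a - b‖ := by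
  have hp0 : 0 < p := by linarith [hp.out]
  have h0 : 0 < (1 - R) ^ (2 + 1 / p) := Real.rpow_pos_of_pos (by linarith) _
  refine (convex_closedBall (0 : ℂ) R).norm_image_sub_le_of_norm_deriv_le (𝕜 := ℂ)
    (fun z hz => ?_) (fun z hz => ?_) (mem_closedBall_zero_iff.2 hb) (mem_closedBall_zero_iff.2 ha)
  · refine f.differentiableOn.differentiableAt (isOpen_ball.mem_nhds ?_)
    exact closedBall_subset_ball hR hz
  · rw [mem_closedBall_zero_iff] at hz
    have h := f.norm_deriv_mul_le (mem_ball_zero_iff.2 (hz.trans_lt hR))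
    have h1 : (1 - R) ^ (2 + 1 / p) ≤ (1 - ‖z‖) ^ (2 + 1 / p) :=
      Real.rpow_le_rpow (by linarith) (by linarith) (by positivity)
    rw [div_mul_eq_mul_div, le_div_iff₀ h0]
    exact (mul_le_mul_of_nonneg_left h1 (norm_nonneg _)).trans h

/-- Evaluation at a point of the disc as a bounded functional. -/
noncomputable def evalCLM (z : ℂ) (hz : z ∈ ball (0 : ℂ) 1) : RM p 1 →L[ℂ] ℂ :=
  LinearMap.mkContinuous
    { toFun := fun f => f z
      map_add' := fun _ _ => rfl
      map_smul' := fun _ _ => rfl } _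
    fun f => f.norm_apply_le (mem_ball_zero_iff.1 hz) le_rfl

/-- Evaluations on compact subsets are uniformly bounded, so a Cauchy sequence converges locally
uniformly to a holomorphic function; lower semicontinuity of the norm upgrades this to norm
convergence. -/
instance : CompleteSpace (RM p 1) := by
  refine Metric.complete_of_cauchySeq_tendsto fun u hu => ?_
  have hp0 : 0 < p := by linarith [hp.out]
  -- The pointwise limit is taken on the whole plane, so that the limit function is again extended
  -- by zero.
  have hz : ∀ z, ∃ w, Tendsto (fun n => u n z) atTop (𝓝 w) ∧ (z ∉ ball (0 : ℂ) 1 → w = 0) := by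
    intro z
    by_cases hz : z ∈ ball (0 : ℂ) 1
    · obtain ⟨w, hw⟩ := cauchySeq_tendsto_of_complete
        ((evalCLM (p := p) z hz).uniformContinuous.comp_cauchySeq hu)
      exact ⟨w, hw, fun h => absurd hz h⟩
    · exact ⟨0, by simp [(u _).apply_eq_zero hz], fun _ => rfl⟩
  choose F hF hF0 using hz
  have hunif : TendstoLocallyUniformlyOn (fun n => (u n : ℂ → ℂ)) F atTop (ball 0 1) := by
    rw [tendstoLocallyUniformlyOn_iff_forall_isCompact isOpen_ball]
    intro K hK hKc
    obtain ⟨R, hR, hKR⟩ : ∃ R < 1, ∀ z ∈ K, ‖z‖ ≤ R := by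
      rcases K.eq_empty_or_nonempty with rfl | hne
      · exact ⟨0, one_pos, by simp⟩
      · obtain ⟨z, hz, hmax⟩ := hKc.exists_isMaxOn hne continuous_norm.continuousOn
        exact ⟨‖z‖, mem_ball_zero_iff.1 (hK hz), hmax⟩
    refine UniformCauchySeqOn.tendstoUniformlyOn_of_tendsto ?_ fun z _ => hF z
    rw [Metric.uniformCauchySeqOn_iff]
    intro ε hε
    set C := 256 * Real.pi / (1 - R) ^ (2 + 1 / p)
    have hC : 0 < C := by
      have : 0 < (1 - R) ^ (2 + 1 / p) := Real.rpow_pos_of_pos (by linarith) _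
      positivity
    obtain ⟨N, hN⟩ := Metric.cauchySeq_iff.1 hu (ε / C) (by positivity)
    refine ⟨N, fun m hm n hn z hz => ?_⟩
    rw [dist_eq_norm]
    have h1 := (u m - u n).norm_apply_le hR (hKR z hz)
    have h2 := hN m hm n hn
    rw [dist_eq_norm, lt_div_iff₀ hC] at h2
    rw [sub_apply] at h1
    linarith
  have hdiff : DifferentiableOn ℂ F (ball 0 1) :=
    hunif.differentiableOn (Eventually.of_forall fun n => (u n).differentiableOn) isOpen_ball
  have hFm : Measurable F := measurable_of_holo hdiff hF0
  have key : ∀ ε > 0, ∃ N, ∀ n ≥ N, rho p 1 (fun z => F z - u n z) ≤ ENNReal.ofReal ε := by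
    intro ε hε
    obtain ⟨N, hN⟩ := Metric.cauchySeq_iff.1 hu ε hε
    refine ⟨N, fun n hn => ?_⟩
    -- Here `n` is fixed and the lower semicontinuity is applied as `m → ∞`.
    refine rho_le_of_tendsto hp.out (u := fun m z => u m z - u n z)
      (fun m => (u m).measurable.sub (u n).measurable) (fun z => (hF z).sub_const _) ?_
    filter_upwards [eventually_ge_atTop N] with m hm
    have : rho p 1 (fun z => u m z - u n z) = ENNReal.ofReal ‖u m - u n‖ :=
      rho_eq_ofReal_norm (u m - u n)
    rw [this, ← dist_eq_norm]
    exact ENNReal.ofReal_le_ofReal (hN m hm n hn).le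
  have hFmem : F ∈ rmSet p 1 := by
    refine ⟨hdiff, hF0, ?_⟩
    obtain ⟨N, hN⟩ := key 1 one_pos
    have e : F = (fun z => F z - u N z) + (u N : ℂ → ℂ) := by ext z; simp
    rw [e]
    refine (rho_add_le hp.out le_rfl (hFm.sub (u N).measurable) (u N).measurable).trans_lt ?_
    exact ENNReal.add_lt_top.2 ⟨(hN N le_rfl).trans_lt ENNReal.ofReal_lt_top, (u N).mem.2.2⟩
  set Fr : RM p 1 := ofMem F hFmem
  refine ⟨Fr, Metric.tendsto_atTop.2 fun ε hε => ?_⟩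
  obtain ⟨N, hN⟩ := key (ε / 2) (half_pos hε)
  refine ⟨N, fun n hn => ?_⟩
  have h1 : ENNReal.ofReal ‖Fr - u n‖ ≤ ENNReal.ofReal (ε / 2) := by
    rw [← rho_eq_ofReal_norm]
    exact hN n hn
  rw [ENNReal.ofReal_le_ofReal_iff (by positivity)] at h1
  rw [dist_comm, dist_eq_norm]
  linarith

end RM

/-! ### The integration operator and its boundedness -/

theorem mul_mem_ball_of_mem_Icc {z : ℂ} (hz : z ∈ ball (0 : ℂ) 1) {s : ℝ}
    (hs : s ∈ Set.Icc (0 : ℝ) 1) : (s : ℂ) * z ∈ ball (0 : ℂ) 1 := by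
  rw [mem_ball_zero_iff] at *
  rw [norm_mul, Complex.norm_real, Real.norm_of_nonneg hs.1]
  exact (mul_le_of_le_one_left (norm_nonneg _) hs.2).trans_lt hz

theorem continuousOn_integrationOperator_integrand {g f : ℂ → ℂ}
    (hg : DifferentiableOn ℂ g (ball 0 1)) (hf : DifferentiableOn ℂ f (ball 0 1)) {z : ℂ}
    (hz : z ∈ ball (0 : ℂ) 1) :
    ContinuousOn (fun s : ℝ => f ((s : ℂ) * z) * deriv g ((s : ℂ) * z) * z) (Set.Icc 0 1) := by
  have hmaps : Set.MapsTo (fun s : ℝ => (s : ℂ) * z) (Set.Icc 0 1) (ball 0 1) :=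
    fun s hs => mul_mem_ball_of_mem_Icc hz hs
  have hc : ContinuousOn (fun s : ℝ => (s : ℂ) * z) (Set.Icc 0 1) := by fun_prop
  exact ((hf.continuousOn.comp hc hmaps).mul
    ((hg.deriv isOpen_ball).continuousOn.comp hc hmaps)).mul continuousOn_const

theorem intervalIntegrable_integrationOperator_integrand {g f : ℂ → ℂ}
    (hg : DifferentiableOn ℂ g (ball 0 1)) (hf : DifferentiableOn ℂ f (ball 0 1)) {z : ℂ}
    (hz : z ∈ ball (0 : ℂ) 1) :
    IntervalIntegrable (fun s : ℝ => f ((s : ℂ) * z) * deriv g ((s : ℂ) * z) * z) volume 0 1 :=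
  ContinuousOn.intervalIntegrable_of_Icc zero_le_one
    (continuousOn_integrationOperator_integrand hg hf hz)

/-- The function `f g'` has a primitive `G` on the disc, and the integral along the segment equals
`G(z) - G(0)`. -/
theorem hasDerivAt_integrationOperator {g f : ℂ → ℂ} (hg : DifferentiableOn ℂ g (ball 0 1))
    (hf : DifferentiableOn ℂ f (ball 0 1)) {z : ℂ} (hz : z ∈ ball (0 : ℂ) 1) :
    HasDerivAt (integrationOperator g f) (f z * deriv g z) z := by
  obtain ⟨G, hG⟩ := (hf.mul (hg.deriv isOpen_ball)).isExactOn_ball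
  have key : ∀ w ∈ ball (0 : ℂ) 1, integrationOperator g f w = G w - G 0 := by
    intro w hw
    have := intervalIntegral.integral_eq_sub_of_hasDerivAt (a := 0) (b := 1)
      (f := fun s : ℝ => G ((s : ℂ) * w))
      (f' := fun s : ℝ => f ((s : ℂ) * w) * deriv g ((s : ℂ) * w) * w) (fun s hs => ?_)
      (intervalIntegrable_integrationOperator_integrand hg hf hw)
    · simpa [integrationOperator] using this
    · rw [Set.uIcc_of_le zero_le_one] at hs
      have h1 : HasDerivAt (fun s : ℂ => s * w) w (s : ℂ) := by
        simpa using (hasDerivAt_id (s : ℂ)).mul_const w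
      exact (HasDerivAt.comp (s : ℂ) (hG _ (mul_mem_ball_of_mem_Icc hw hs)) h1).comp_ofReal
  refine ((hG z hz).sub_const (G 0)).congr_of_eventuallyEq ?_
  filter_upwards [isOpen_ball.mem_nhds hz] with w hw using key w hw

/-- `T_g f`, extended by zero off the disc. -/
noncomputable def integrationExt (g f : ℂ → ℂ) : ℂ → ℂ :=
  (ball (0 : ℂ) 1).indicator (integrationOperator g f)

theorem integrationExt_apply (g f : ℂ → ℂ) {z : ℂ} (hz : z ∈ ball (0 : ℂ) 1) :
    integrationExt g f z = integrationOperator g f z := Set.indicator_of_mem hz _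

theorem hasDerivAt_integrationExt {g f : ℂ → ℂ} (hg : DifferentiableOn ℂ g (ball 0 1))
    (hf : DifferentiableOn ℂ f (ball 0 1)) {z : ℂ} (hz : z ∈ ball (0 : ℂ) 1) :
    HasDerivAt (integrationExt g f) (f z * deriv g z) z := by
  refine (hasDerivAt_integrationOperator hg hf hz).congr_of_eventuallyEq ?_
  filter_upwards [isOpen_ball.mem_nhds hz] with w hw using integrationExt_apply g f hw

/-- The segment from `0` to `r e^{it}` stays on one ray, so the operator is dominated by a
one-dimensional integral for each angle separately. -/
theorem enorm_polarVal_integrationExt_le (g f : ℂ → ℂ) (t : ℝ) {r : ℝ}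
    (hr : r ∈ Set.Ico (0 : ℝ) 1) :
    ‖polarVal (integrationExt g f) t r‖ₑ ≤
      ∫⁻ s in Set.Ico (0 : ℝ) r, ‖polarVal f t s‖ₑ * ‖polarVal (deriv g) t s‖ₑ := by
  have hz : (r : ℂ) * Complex.exp ((t : ℂ) * Complex.I) ∈ ball (0 : ℂ) 1 := by
    rw [mem_ball_zero_iff, norm_mul_exp_mul_I hr.1]; exact hr.2
  rw [polarVal, integrationExt_apply _ _ hz, integrationOperator]
  have h := intervalIntegral.smul_integral_comp_mul_right (a := 0) (b := 1) (fun s : ℝ =>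
    polarVal f t s * polarVal (deriv g) t s * Complex.exp ((t : ℂ) * Complex.I)) r
  rw [zero_mul, one_mul, ← intervalIntegral.integral_smul] at h
  have e : (∫ s in (0 : ℝ)..1, f ((s : ℂ) * ((r : ℂ) * Complex.exp ((t : ℂ) * Complex.I))) *
      deriv g ((s : ℂ) * ((r : ℂ) * Complex.exp ((t : ℂ) * Complex.I))) *
      ((r : ℂ) * Complex.exp ((t : ℂ) * Complex.I))) = ∫ s in (0 : ℝ)..r,
      polarVal f t s * polarVal (deriv g) t s * Complex.exp ((t : ℂ) * Complex.I) := by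
    rw [← h]
    refine intervalIntegral.integral_congr fun s _ => ?_
    simp only [polarVal, Complex.ofReal_mul, Complex.real_smul, mul_assoc]
    ring
  rw [e, intervalIntegral.integral_of_le hr.1, setIntegral_congr_set Ico_ae_eq_Ioc.symm]
  refine (enorm_integral_le_lintegral_enorm _).trans_eq (lintegral_congr fun s => ?_)
  rw [enorm_mul, enorm_mul, ← ofReal_norm (Complex.exp _), Complex.norm_exp_ofReal_mul_I,
    ENNReal.ofReal_one, mul_one]

/-- The split hypothesis serves two purposes: `A = 0` with the Bloch constant as `ε` gives
boundedness, while a small `ε` near the boundary and a small `A` on an inner disc give compactness.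
Hardy's inequality handles the second term. -/
theorem radial_integrationExt_le {p : ℝ} (hp : 1 ≤ p) {g f : ℂ → ℂ} (hf : Measurable f)
    {A ε : ℝ} (hA : 0 ≤ A) (hε : 0 ≤ ε)
    (h : ∀ z ∈ ball (0 : ℂ) 1, ‖f z‖ * ‖deriv g z‖ ≤ A + ε * (‖f z‖ / (1 - ‖z‖))) (t : ℝ) :
    radial p (integrationExt g f) t ≤
      ENNReal.ofReal A + ENNReal.ofReal ε * (ENNReal.ofReal p * radial p f t) := by
  refine radial_le_of_enorm_le hp hf _ _ ENNReal.ofReal_ne_top t fun r hr => ?_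
  refine (enorm_polarVal_integrationExt_le g f t hr).trans ?_
  calc _ ≤ ∫⁻ s in Set.Ico (0 : ℝ) r, (ENNReal.ofReal A +
        ENNReal.ofReal ε * (‖polarVal f t s‖ₑ / ENNReal.ofReal (1 - s))) := by
        refine setLIntegral_mono' measurableSet_Ico fun s hs => ?_
        have hs1 : 0 < 1 - s := by linarith [hs.2, hr.2]
        have hn := norm_mul_exp_mul_I hs.1 t
        have := h ((s : ℂ) * Complex.exp ((t : ℂ) * Complex.I)) (by
          rw [mem_ball_zero_iff, hn]; linarith)
        rw [hn] at this
        rw [← ofReal_norm, ← ofReal_norm, ← ENNReal.ofReal_mul (norm_nonneg _),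
          ← ENNReal.ofReal_div_of_pos hs1, ← ENNReal.ofReal_mul hε,
          ← ENNReal.ofReal_add hA (by positivity)]
        exact ENNReal.ofReal_le_ofReal this
    _ = ENNReal.ofReal A * ENNReal.ofReal r + ENNReal.ofReal ε * ∫⁻ s in Set.Ico (0 : ℝ) r,
        ‖polarVal f t s‖ₑ / ENNReal.ofReal (1 - s) := by
        rw [lintegral_add_left measurable_const, lintegral_const_mul' _ _ (by finiteness),
          setLIntegral_const, Real.volume_Ico, sub_zero]
    _ ≤ _ := by
        gcongr
        refine mul_le_of_le_one_right (zero_le) ?_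
        rw [← ENNReal.ofReal_one]
        exact ENNReal.ofReal_le_ofReal hr.2.le

theorem rho_integrationExt_le {p : ℝ} (hp : 1 ≤ p) {g f : ℂ → ℂ} (hf : Measurable f)
    {A ε : ℝ} (hA : 0 ≤ A) (hε : 0 ≤ ε)
    (h : ∀ z ∈ ball (0 : ℂ) 1, ‖f z‖ * ‖deriv g z‖ ≤ A + ε * (‖f z‖ / (1 - ‖z‖))) :
    rho p 1 (integrationExt g f) ≤
      ENNReal.ofReal A + ENNReal.ofReal (ε * p) * rho p 1 f := by
  rw [rho_one_eq, rho_one_eq]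
  calc _ ≤ ENNReal.ofReal (1 / (2 * Real.pi)) * ∫⁻ t in Set.Ico (0 : ℝ) (2 * Real.pi),
        (ENNReal.ofReal A + ENNReal.ofReal (ε * p) * radial p f t) := by
        gcongr with t
        rw [ENNReal.ofReal_mul hε, mul_assoc]
        exact radial_integrationExt_le hp hf hA hε h t
    _ = (ENNReal.ofReal (1 / (2 * Real.pi)) * ENNReal.ofReal (2 * Real.pi)) * ENNReal.ofReal A +
        ENNReal.ofReal (ε * p) * (ENNReal.ofReal (1 / (2 * Real.pi)) *
          ∫⁻ t in Set.Ico (0 : ℝ) (2 * Real.pi), radial p f t) := by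
        rw [lintegral_add_left measurable_const, lintegral_const_mul' _ _ (by finiteness),
          setLIntegral_const, Real.volume_Ico, sub_zero]
        ring
    _ = _ := by
        rw [← ENNReal.ofReal_mul (by positivity), one_div_mul_cancel (by positivity),
          ENNReal.ofReal_one, one_mul]

/-- The Bloch bound in the form used on rays. -/
theorem exists_norm_deriv_le_of_mem_blochSpace {g : ℂ → ℂ} (hg : g ∈ blochSpace) :
    ∃ C : ℝ, 0 < C ∧ ∀ z ∈ ball (0 : ℂ) 1, ‖deriv g z‖ ≤ C / (1 - ‖z‖) := by
  obtain ⟨-, C, hC⟩ := hg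
  refine ⟨max C 1, by positivity, fun z hz => ?_⟩
  have h := hC z hz
  rw [mem_ball_zero_iff] at hz
  rw [le_div_iff₀ (by linarith)]
  refine le_trans ?_ (le_max_left _ _)
  refine le_trans ?_ h
  rw [mul_comm]
  gcongr
  nlinarith [norm_nonneg z]

namespace RM

variable {p : ℝ} [hp : Fact (1 ≤ p)]

theorem integrationExt_mem {g : ℂ → ℂ} (hg : g ∈ blochSpace) (f : RM p 1) :
    integrationExt g f ∈ rmSet p 1 := by
  refine ⟨fun z hz => ((hasDerivAt_integrationExt hg.1 f.differentiableOn
    hz).differentiableAt).differentiableWithinAt, fun z hz => Set.indicator_of_notMem hz _, ?_⟩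
  obtain ⟨C, hC, h⟩ := exists_norm_deriv_le_of_mem_blochSpace hg
  refine (rho_integrationExt_le hp.out f.measurable le_rfl hC.le fun z hz => ?_).trans_lt ?_
  · calc _ ≤ ‖f z‖ * (C / (1 - ‖z‖)) := by gcongr; exact h z hz
      _ = _ := by ring
  · have := f.mem.2.2
    finiteness

/-- The integration operator as a linear map on `RM(p,1)`. -/
noncomputable def integrationLM (g : ℂ → ℂ) (hg : g ∈ blochSpace) : RM p 1 →ₗ[ℂ] RM p 1 where
  toFun f := ofMem _ (integrationExt_mem hg f)
  map_add' f h := by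
    refine RM.ext fun z hz => ?_
    change integrationExt g (f + h : RM p 1) z = integrationExt g f z + integrationExt g h z
    simp only [integrationExt_apply _ _ hz, integrationOperator, add_apply, add_mul]
    exact intervalIntegral.integral_add
      (intervalIntegrable_integrationOperator_integrand hg.1 f.differentiableOn hz)
      (intervalIntegrable_integrationOperator_integrand hg.1 h.differentiableOn hz)
  map_smul' c f := by
    refine RM.ext fun z hz => ?_
    change integrationExt g (c • f : RM p 1) z = c * integrationExt g f z
    simp only [integrationExt_apply _ _ hz, integrationOperator, smul_apply, mul_assoc]
    exact intervalIntegral.integral_const_mul _ _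

theorem coe_integrationLM (g : ℂ → ℂ) (hg : g ∈ blochSpace) (f : RM p 1) :
    (integrationLM g hg f : ℂ → ℂ) = integrationExt g f := rfl

theorem norm_integrationLM_le {g : ℂ → ℂ} (hg : g ∈ blochSpace) (f : RM p 1) {A ε : ℝ}
    (hA : 0 ≤ A) (hε : 0 ≤ ε)
    (h : ∀ z ∈ ball (0 : ℂ) 1, ‖f z‖ * ‖deriv g z‖ ≤ A + ε * (‖f z‖ / (1 - ‖z‖))) :
    ‖integrationLM g hg f‖ ≤ A + ε * p * ‖f‖ := by
  have hp0 : 0 < p := by linarith [hp.out]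
  have h := rho_integrationExt_le hp.out f.measurable hA hε h
  rw [← coe_integrationLM g hg, rho_eq_ofReal_norm, rho_eq_ofReal_norm,
    ← ENNReal.ofReal_mul (by positivity), ← ENNReal.ofReal_add hA (by positivity),
    ENNReal.ofReal_le_ofReal_iff (by positivity)] at h
  exact h

/-- The integration operator `T_g` with a Bloch symbol, as a bounded operator on `RM(p,1)`. -/
noncomputable def integrationCLM (g : ℂ → ℂ) (hg : g ∈ blochSpace) : RM p 1 →L[ℂ] RM p 1 :=
  (integrationLM g hg).mkContinuousOfExistsBound <| by
    obtain ⟨C, hC, h⟩ := exists_norm_deriv_le_of_mem_blochSpace hg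
    refine ⟨C * p, fun f => ?_⟩
    refine (norm_integrationLM_le hg f le_rfl hC.le fun z hz => ?_).trans_eq (zero_add _)
    calc _ ≤ ‖f z‖ * (C / (1 - ‖z‖)) := by gcongr; exact h z hz
      _ = _ := by ring

theorem coe_integrationCLM (g : ℂ → ℂ) (hg : g ∈ blochSpace) (f : RM p 1) :
    (integrationCLM g hg f : ℂ → ℂ) = integrationExt g f := rfl

theorem norm_integrationCLM_le {g : ℂ → ℂ} (hg : g ∈ blochSpace) (f : RM p 1) {A ε : ℝ}
    (hA : 0 ≤ A) (hε : 0 ≤ ε)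
    (h : ∀ z ∈ ball (0 : ℂ) 1, ‖f z‖ * ‖deriv g z‖ ≤ A + ε * (‖f z‖ / (1 - ‖z‖))) :
    ‖integrationCLM g hg f‖ ≤ A + ε * p * ‖f‖ :=
  norm_integrationLM_le hg f hA hε h

end RM

/-! ### Compactness for little Bloch symbols -/

/-- A bounded operator that is small wherever finitely many functionals are small is compact. -/
theorem isCompactOperator_of_finite_functionals {E F : Type*} [NormedAddCommGroup E]
    [NormedSpace ℂ E] [NormedAddCommGroup F] [NormedSpace ℂ F] [CompleteSpace F] (T : E →L[ℂ] F)
    (h : ∀ ε > 0, ∃ (n : Type) (_ : Fintype n) (L : E →L[ℂ] (n → ℂ)) (δ : ℝ), 0 < δ ∧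
      ∀ x, ‖x‖ ≤ 2 → ‖L x‖ ≤ δ → ‖T x‖ ≤ ε) : IsCompactOperator T := by
  refine (isCompactOperator_iff_isCompact_closure_image_closedBall (T : E →ₗ[ℂ] F)
    one_pos).2 ?_
  refine isCompact_iff_totallyBounded_isComplete.2
    ⟨TotallyBounded.closure ?_, isClosed_closure.isComplete⟩
  rw [Metric.totallyBounded_iff]
  intro ε hε
  obtain ⟨n, _, L, δ, hδ, hL⟩ := h (ε / 2) (half_pos hε)
  have hb : TotallyBounded (L '' closedBall (0 : E) 1) :=
    (L.lipschitz.isBounded_image isBounded_closedBall).isCompact_closure.totallyBounded.subset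
      subset_closure
  -- The net is chosen inside the image of the unit ball, so its centres lift to points of the ball;
  -- differences then have norm at most `2`, whence the `2` in the hypothesis.
  obtain ⟨t', ht', htf', hcov⟩ := Set.exists_subset_image_finite_and.1
    (Metric.finite_approx_of_totallyBounded hb δ hδ)
  refine ⟨T '' t', htf'.image _, ?_⟩
  rintro _ ⟨x, hx, rfl⟩
  have := hcov (Set.mem_image_of_mem L hx)
  simp only [Set.mem_iUnion, Set.mem_image, exists_prop, exists_exists_and_eq_and] at this ⊢
  obtain ⟨y, hy, hxy⟩ := this
  refine ⟨y, hy, ?_⟩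
  rw [mem_ball_iff_norm, ← map_sub] at hxy
  rw [mem_ball_iff_norm]
  change ‖T x - T y‖ < ε
  rw [← map_sub]
  have h1 := mem_closedBall_zero_iff.1 hx
  have h2 := mem_closedBall_zero_iff.1 (ht' hy)
  refine (hL (x - y) ?_ hxy.le).trans_lt (half_lt_self hε)
  linarith [norm_sub_le x y]

theorem exists_norm_deriv_le_of_mem_littleBlochSpace {g : ℂ → ℂ} (hg : g ∈ littleBlochSpace)
    {ε : ℝ} (hε : 0 < ε) :
    ∃ R < 1, ∀ z ∈ ball (0 : ℂ) 1, R < ‖z‖ → ‖deriv g z‖ ≤ ε / (1 - ‖z‖) := by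
  have h := hg.2.eventually (gt_mem_nhds hε)
  rw [eventually_comap] at h
  obtain ⟨R, hR, hRs⟩ := mem_nhdsLT_iff_exists_Ioo_subset.1 h
  refine ⟨R, hR, fun z hz hRz => ?_⟩
  rw [mem_ball_zero_iff] at hz
  have h1 := hRs ⟨hRz, hz⟩ z rfl
  rw [le_div_iff₀ (by linarith), mul_comm]
  refine le_trans ?_ h1.le
  gcongr
  nlinarith [norm_nonneg z]

namespace RM

variable {p : ℝ} [hp : Fact (1 ≤ p)]

theorem isCompactOperator_integrationCLM {g : ℂ → ℂ} (hg : g ∈ blochSpace)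
    (hg0 : g ∈ littleBlochSpace) :
    IsCompactOperator (integrationCLM g hg : RM p 1 →L[ℂ] RM p 1) := by
  have hp0 : 0 < p := by linarith [hp.out]
  refine isCompactOperator_of_finite_functionals _ fun ε hε => ?_
  obtain ⟨C, hC, hgC⟩ := exists_norm_deriv_le_of_mem_blochSpace hg
  -- Hardy's constant `p` and `‖f‖ ≤ 2` turn `ε / (4p)` into `ε / 2`.
  obtain ⟨R, hR, hgR⟩ := exists_norm_deriv_le_of_mem_littleBlochSpace hg0
    (show 0 < ε / (4 * p) by positivity)
  have hR' : 0 < 1 - R := by linarith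
  -- Chosen so that `|f| ≤ η` and `|g'| ≤ C / (1 - R)` on the inner disc give `|f g'| ≤ ε / 2`.
  set η := ε * (1 - R) / (2 * C) with hη
  have hη0 : 0 < η := by positivity
  set K := 128 * Real.pi / (1 - R) ^ (2 + 1 / p)
  have hK : 0 < K := by
    have := Real.rpow_pos_of_pos hR' (2 + 1 / p)
    positivity
  -- The Lipschitz constant on `|z| ≤ R` is at most `2 K`, so this mesh changes the values of `f` by
  -- at most `η / 2`.
  obtain ⟨t, ht, htf, hcov⟩ := Metric.finite_approx_of_totallyBounded
    (isCompact_closedBall (0 : ℂ) R).totallyBounded (η / (4 * K)) (by positivity)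
  have htb : ∀ y ∈ t, y ∈ ball (0 : ℂ) 1 := fun y hy => closedBall_subset_ball hR (ht hy)
  refine ⟨t, htf.fintype, ?_⟩
  let _ := htf.fintype
  refine ⟨ContinuousLinearMap.pi fun y : t => evalCLM (p := p) y (htb y y.2), η / 2, half_pos hη0,
    fun f hf hLf => ?_⟩
  have hsmall : ∀ z, ‖z‖ ≤ R → ‖f z‖ ≤ η := by
    intro z hz
    have hzc := hcov (mem_closedBall_zero_iff.2 hz)
    simp only [Set.mem_iUnion, exists_prop] at hzc
    obtain ⟨y, hy, hzy⟩ := hzc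
    rw [mem_ball_iff_norm] at hzy
    have h1 : ‖f y‖ ≤ η / 2 := (norm_le_pi_norm
      ((ContinuousLinearMap.pi fun y : t => evalCLM (p := p) y (htb y y.2)) f) ⟨y, hy⟩).trans hLf
    have h2 := f.norm_sub_apply_le hR hz (mem_closedBall_zero_iff.1 (ht hy))
    have h3 : K * ‖f‖ * ‖z - y‖ ≤ K * 2 * (η / (4 * K)) := by gcongr
    have h4 : K * 2 * (η / (4 * K)) = η / 2 := by field_simp; ring
    have h5 := norm_sub_norm_le (f z) (f y)
    linarith
  have key := norm_integrationCLM_le hg f (A := ε / 2) (ε := ε / (4 * p)) (by positivity)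
    (by positivity) fun z hz => ?_
  · refine key.trans ?_
    have : ε / (4 * p) * p * ‖f‖ ≤ ε / (4 * p) * p * 2 := by gcongr
    have e : ε / (4 * p) * p * 2 = ε / 2 := by field_simp; ring
    linarith
  · have hz1 := mem_ball_zero_iff.1 hz
    have hz1' : 0 < 1 - ‖z‖ := by linarith
    rcases le_or_gt ‖z‖ R with hzR | hzR
    · have h1 : ‖f z‖ * ‖deriv g z‖ ≤ η * (C / (1 - R)) := by
        gcongr
        · exact hsmall z hzR
        · refine (hgC z hz).trans ?_
          gcongr
      have h2 : η * (C / (1 - R)) = ε / 2 := by rw [hη]; field_simp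
      have h3 : 0 ≤ ε / (4 * p) * (‖f z‖ / (1 - ‖z‖)) := by positivity
      linarith
    · calc _ ≤ ‖f z‖ * (ε / (4 * p) / (1 - ‖z‖)) := by gcongr; exact hgR z hz hzR
        _ = ε / (4 * p) * (‖f z‖ / (1 - ‖z‖)) := by ring
        _ ≤ _ := le_add_of_nonneg_left (by positivity)

end RM

/-! ### Peak functions and their images -/

theorem norm_sub_exp_mul_I_pos {a : ℂ} (ha : a ∈ ball (0 : ℂ) 1) (t : ℝ) :
    0 < ‖Complex.exp ((t : ℂ) * Complex.I) - a‖ := by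
  rw [norm_pos_iff, sub_ne_zero]
  rintro rfl
  rw [mem_ball_zero_iff, Complex.norm_exp_ofReal_mul_I] at ha
  exact lt_irrefl _ ha

/-- Since `1 - |a| ≤ 1 - |a|²`, the integrand is below the Poisson kernel, whose mean over the
circle is `1`. -/
theorem lintegral_inv_norm_sub_sq {a : ℂ} (ha : a ∈ ball (0 : ℂ) 1) :
    ∫⁻ t in Set.Ico (0 : ℝ) (2 * Real.pi),
      ENNReal.ofReal ((1 - ‖a‖) / ‖Complex.exp ((t : ℂ) * Complex.I) - a‖ ^ 2) ≤
      ENNReal.ofReal (2 * Real.pi) := by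
  have ha1 := mem_ball_zero_iff.1 ha
  have hd : DiffContOnCl ℂ (fun _ : ℂ => (1 : ℂ)) (ball 0 1) := diffContOnCl_const
  have h := hd.circleAverage_poissonKernel_smul' ha
  have hcont : Continuous fun t : ℝ =>
      (1 - ‖a‖ ^ 2) / ‖Complex.exp ((t : ℂ) * Complex.I) - a‖ ^ 2 := by
    refine Continuous.div continuous_const (by fun_prop) fun t => ?_
    have := norm_sub_exp_mul_I_pos ha t
    positivity
  have h' : ∫ t in (0 : ℝ)..2 * Real.pi,
      (1 - ‖a‖ ^ 2) / ‖Complex.exp ((t : ℂ) * Complex.I) - a‖ ^ 2 = 2 * Real.pi := by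
    rw [Real.circleAverage_def] at h
    simp only [circleMap, sub_zero, zero_add, Complex.ofReal_one, one_mul,
      Complex.norm_exp_ofReal_mul_I, one_pow, Complex.real_smul, mul_one] at h
    rw [intervalIntegral.integral_ofReal, ← Complex.ofReal_mul] at h
    have h2 : (2 * Real.pi)⁻¹ * ∫ t in (0 : ℝ)..2 * Real.pi,
      (1 - ‖a‖ ^ 2) / ‖Complex.exp ((t : ℂ) * Complex.I) - a‖ ^ 2 = 1 := by exact_mod_cast h
    have hpi := Real.two_pi_pos.ne'
    field_simp at h2
    linarith
  have hnn : ∀ t : ℝ, 0 ≤ (1 - ‖a‖ ^ 2) / ‖Complex.exp ((t : ℂ) * Complex.I) - a‖ ^ 2 := by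
    intro t
    have : 0 ≤ 1 - ‖a‖ ^ 2 := by nlinarith [norm_nonneg a]
    positivity
  calc _ ≤ ∫⁻ t in Set.Ico (0 : ℝ) (2 * Real.pi),
        ENNReal.ofReal ((1 - ‖a‖ ^ 2) / ‖Complex.exp ((t : ℂ) * Complex.I) - a‖ ^ 2) := by
        gcongr with t
        nlinarith [norm_nonneg a]
    _ = ENNReal.ofReal (∫ t in (0 : ℝ)..2 * Real.pi,
          (1 - ‖a‖ ^ 2) / ‖Complex.exp ((t : ℂ) * Complex.I) - a‖ ^ 2) := by
        rw [intervalIntegral.integral_of_le Real.two_pi_pos.le, setLIntegral_congr Ico_ae_eq_Ioc,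
          ofReal_integral_eq_lintegral_ofReal (hcont.integrableOn_Ioc)
            (Eventually.of_forall hnn)]
    _ ≤ _ := by rw [h']

/-- A kernel concentrated near `a`, of norm at most one in `RM(p,1)`, extended by zero. -/
noncomputable def peak (p : ℝ) (a : ℂ) : ℂ → ℂ :=
  (ball (0 : ℂ) 1).indicator fun z =>
    (((1 - ‖a‖) ^ (3 - 1 / p) / 16 : ℝ) : ℂ) * ((1 - (starRingEnd ℂ) a * z) ^ 4)⁻¹

theorem one_sub_mul_le_norm (a z : ℂ) : 1 - ‖a‖ * ‖z‖ ≤ ‖1 - (starRingEnd ℂ) a * z‖ := by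
  have h := norm_sub_norm_le (1 : ℂ) ((starRingEnd ℂ) a * z)
  rwa [norm_one, norm_mul, RCLike.norm_conj] at h

theorem one_sub_conj_mul_ne_zero {a z : ℂ} (ha : a ∈ ball (0 : ℂ) 1) (hz : z ∈ ball (0 : ℂ) 1) :
    1 - (starRingEnd ℂ) a * z ≠ 0 := by
  rw [mem_ball_zero_iff] at ha hz
  rw [← norm_pos_iff]
  refine lt_of_lt_of_le ?_ (one_sub_mul_le_norm a z)
  nlinarith [norm_nonneg a, norm_nonneg z]

theorem norm_one_sub_conj_mul_exp (a : ℂ) (t : ℝ) :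
    ‖1 - (starRingEnd ℂ) a * Complex.exp ((t : ℂ) * Complex.I)‖ =
      ‖Complex.exp ((t : ℂ) * Complex.I) - a‖ := by
  set e := Complex.exp ((t : ℂ) * Complex.I) with he
  have h1 : ‖e‖ = 1 := Complex.norm_exp_ofReal_mul_I t
  have h2 : (starRingEnd ℂ) e * e = 1 := by rw [Complex.conj_mul', h1]; norm_num
  calc ‖1 - (starRingEnd ℂ) a * e‖ = ‖(starRingEnd ℂ) (e - a) * e‖ := by
        rw [map_sub, sub_mul, h2]
    _ = _ := by rw [norm_mul, RCLike.norm_conj, h1, mul_one]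

theorem differentiableOn_peak (p : ℝ) {a : ℂ} (ha : a ∈ ball (0 : ℂ) 1) :
    DifferentiableOn ℂ (peak p a) (ball 0 1) := by
  have h : DifferentiableOn ℂ (fun z =>
      (((1 - ‖a‖) ^ (3 - 1 / p) / 16 : ℝ) : ℂ) * ((1 - (starRingEnd ℂ) a * z) ^ 4)⁻¹)
      (ball 0 1) := by
    intro z hz
    have := one_sub_conj_mul_ne_zero ha hz
    have h4 : (1 - (starRingEnd ℂ) a * z) ^ 4 ≠ 0 := pow_ne_zero _ this
    fun_prop (disch := assumption)
  exact h.congr fun z hz => Set.indicator_of_mem hz _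

theorem norm_peak_apply {p : ℝ} {a z : ℂ} (ha : a ∈ ball (0 : ℂ) 1) (hz : z ∈ ball (0 : ℂ) 1) :
    ‖peak p a z‖ = (1 - ‖a‖) ^ (3 - 1 / p) / 16 / ‖1 - (starRingEnd ℂ) a * z‖ ^ 4 := by
  rw [mem_ball_zero_iff] at ha
  have : 0 ≤ (1 - ‖a‖) ^ (3 - 1 / p) / 16 := by
    have := Real.rpow_nonneg (show 0 ≤ 1 - ‖a‖ by linarith) (3 - 1 / p)
    positivity
  rw [peak, Set.indicator_of_mem hz, norm_mul, norm_inv, norm_pow, Complex.norm_real,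
    Real.norm_of_nonneg this, div_eq_mul_inv _ (_ ^ 4)]

/-- Both `1 - |a| + 1 - r` and `|e^{it} - a|` are at most twice `|1 - ā z|`. Two of the four factors
of the denominator are spent on each: the first pair is integrated in `r`, the second gives the
Poisson-type kernel. The `16` in `peak` absorbs the factors `2`, and the powers of `1 - |a|` combine
to `1`. -/
theorem radial_peak_le {p : ℝ} (hp : 1 ≤ p) {a : ℂ} (ha : a ∈ ball (0 : ℂ) 1) (t : ℝ) :
    radial p (peak p a) t ≤
      ENNReal.ofReal ((1 - ‖a‖) / ‖Complex.exp ((t : ℂ) * Complex.I) - a‖ ^ 2) := by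
  have hp0 : 0 < p := by linarith
  have ha1 := mem_ball_zero_iff.1 ha
  have hE := norm_sub_exp_mul_I_pos ha t
  set E := ‖Complex.exp ((t : ℂ) * Complex.I) - a‖ with hEdef
  set δ := 1 - ‖a‖ with hδ
  have hδ0 : 0 < δ := by linarith
  -- The exponent is `-2p`, written in the form required by `lintegral_Ioo_rpow_tail_le` with `s =
  -- 2p - 1 ≥ 1`.
  have hpt : ∀ r ∈ Set.Ico (0 : ℝ) 1, ‖polarVal (peak p a) t r‖ₑ ^ p ≤
      ENNReal.ofReal (δ ^ (3 - 1 / p) / E ^ 2) ^ p *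
        ENNReal.ofReal ((δ + (1 - r)) ^ (-1 - (2 * p - 1))) := by
    intro r hr
    have hn := norm_mul_exp_mul_I hr.1 t
    have hz : (r : ℂ) * Complex.exp ((t : ℂ) * Complex.I) ∈ ball (0 : ℂ) 1 := by
      rw [mem_ball_zero_iff, hn]; exact hr.2
    have hy : 0 < δ + (1 - r) := by linarith [hr.2]
    have e1 : (δ + (1 - r)) ^ (-1 - (2 * p - 1)) = (((δ + (1 - r)) ^ 2)⁻¹) ^ p := by
      rw [Real.inv_rpow (by positivity), ← Real.rpow_natCast, ← Real.rpow_mul hy.le,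
        ← Real.rpow_neg hy.le]
      congr 1; push_cast; ring
    rw [e1, ← ENNReal.ofReal_rpow_of_pos (by positivity), ← ENNReal.mul_rpow_of_nonneg _ _ hp0.le]
    gcongr
    rw [← ENNReal.ofReal_mul (by positivity), ← ofReal_norm]
    apply ENNReal.ofReal_le_ofReal
    rw [polarVal, norm_peak_apply ha hz, div_mul_eq_mul_div, ← div_eq_mul_inv, div_div, div_div]
    set D := ‖1 - (starRingEnd ℂ) a * ((r : ℂ) * Complex.exp ((t : ℂ) * Complex.I))‖ with hD
    have hD1 : 1 - ‖a‖ * r ≤ D := by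
      have := one_sub_mul_le_norm a ((r : ℂ) * Complex.exp ((t : ℂ) * Complex.I))
      rwa [hn] at this
    have hD2 : (δ + (1 - r)) / 2 ≤ D := by
      refine le_trans ?_ hD1
      nlinarith [norm_nonneg a, hr.1, hr.2]
    -- Moving from radius `r` to the circle changes `1 - ā z` by at most `1 - r`, which is itself at
    -- most `D`.
    have hD3 : E / 2 ≤ D := by
      have h1 : E ≤ D + (1 - r) := by
        rw [hEdef, ← norm_one_sub_conj_mul_exp]
        have e : 1 - (starRingEnd ℂ) a * Complex.exp ((t : ℂ) * Complex.I) =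
            (1 - (starRingEnd ℂ) a * ((r : ℂ) * Complex.exp ((t : ℂ) * Complex.I))) -
            (starRingEnd ℂ) a * (((1 - r : ℝ) : ℂ) * Complex.exp ((t : ℂ) * Complex.I)) := by
          push_cast; ring
        rw [e]
        refine (norm_sub_le _ _).trans ?_
        gcongr
        rw [norm_mul, norm_mul_exp_mul_I (by linarith [hr.2]), RCLike.norm_conj]
        exact mul_le_of_le_one_left (by linarith [hr.2]) ha1.le
      have h2 : 1 - r ≤ D := by
        refine le_trans ?_ hD1
        nlinarith [norm_nonneg a, hr.1, hr.2]
      linarith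
    have hδp : 0 ≤ δ ^ (3 - 1 / p) := by positivity
    refine div_le_div_of_nonneg_left hδp (by positivity) ?_
    have h1 : ((δ + (1 - r)) / 2) ^ 2 ≤ D ^ 2 := pow_le_pow_left₀ (by positivity) hD2 2
    have h2 : (E / 2) ^ 2 ≤ D ^ 2 := pow_le_pow_left₀ (by positivity) hD3 2
    calc (δ + (1 - r)) ^ 2 * E ^ 2 = 16 * ((E / 2) ^ 2 * ((δ + (1 - r)) / 2) ^ 2) := by ring
      _ ≤ 16 * (D ^ 2 * D ^ 2) := by gcongr
      _ = _ := by ring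
  have hint : ∫⁻ r in Set.Ico (0 : ℝ) 1,
      ENNReal.ofReal ((δ + (1 - r)) ^ (-1 - (2 * p - 1))) ≤ ENNReal.ofReal (δ ^ (-(2 * p - 1))) := by
    have e : ∫⁻ r in Set.Ico (0 : ℝ) 1, ENNReal.ofReal ((δ + (1 - r)) ^ (-1 - (2 * p - 1))) =
        ∫⁻ y in Set.Ioo δ (δ + 1), ENNReal.ofReal (y ^ (-1 - (2 * p - 1))) := by
      rw [setLIntegral_congr Ico_ae_eq_Ioc, ← setLIntegral_congr Ioo_ae_eq_Ioc,
        ← lintegral_indicator measurableSet_Ioo, ← lintegral_indicator measurableSet_Ioo,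
        ← lintegral_sub_left_eq_self _ (δ + 1)]
      refine lintegral_congr fun y => ?_
      have : (δ + 1 - y ∈ Set.Ioo (0 : ℝ) 1) ↔ y ∈ Set.Ioo δ (δ + 1) := by
        simp only [Set.mem_Ioo]; constructor <;> rintro ⟨_, _⟩ <;> constructor <;> linarith
      simp only [Set.indicator, this]
      rw [show δ + (1 - (δ + 1 - y)) = y by ring]
    rw [e]
    refine (lintegral_Ioo_rpow_tail_le hδ0 _ (by linarith)).trans (ENNReal.ofReal_le_ofReal ?_)
    exact div_le_self (by positivity) (by linarith)
  calc radial p (peak p a) t ≤ (∫⁻ r in Set.Ico (0 : ℝ) 1,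
        ENNReal.ofReal (δ ^ (3 - 1 / p) / E ^ 2) ^ p *
          ENNReal.ofReal ((δ + (1 - r)) ^ (-1 - (2 * p - 1)))) ^ (1 / p) := by
        unfold radial
        gcongr ?_ ^ _
        exact setLIntegral_mono' measurableSet_Ico hpt
    _ ≤ (ENNReal.ofReal (δ ^ (3 - 1 / p) / E ^ 2) ^ p *
          ENNReal.ofReal (δ ^ (-(2 * p - 1)))) ^ (1 / p) := by
        gcongr
        rw [lintegral_const_mul' _ _ (by finiteness)]
        gcongr
    _ = ENNReal.ofReal (δ / E ^ 2) := by
        rw [ENNReal.mul_rpow_of_nonneg _ _ (by positivity), ← ENNReal.rpow_mul,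
          mul_one_div_cancel hp0.ne', ENNReal.rpow_one,
          ENNReal.ofReal_rpow_of_pos (by positivity), ← ENNReal.ofReal_mul (by positivity),
          ← Real.rpow_mul hδ0.le]
        congr 1
        rw [div_mul_eq_mul_div, ← Real.rpow_add hδ0]
        congr 1
        conv_rhs => rw [← Real.rpow_one δ]
        congr 1
        field_simp
        ring

theorem rho_peak_le {p : ℝ} (hp : 1 ≤ p) {a : ℂ} (ha : a ∈ ball (0 : ℂ) 1) :
    rho p 1 (peak p a) ≤ 1 := by
  rw [rho_one_eq]
  calc _ ≤ ENNReal.ofReal (1 / (2 * Real.pi)) * ENNReal.ofReal (2 * Real.pi) := by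
        gcongr
        exact (lintegral_mono fun t => radial_peak_le hp ha t).trans (lintegral_inv_norm_sub_sq ha)
    _ = 1 := by
        rw [← ENNReal.ofReal_mul (by positivity), one_div_mul_cancel (by positivity),
          ENNReal.ofReal_one]

/-- Because `3 - 1/p ≥ 1`, the normalising factor decays at least like `1 - |a|`: the peaks vanish
on compact sets as `|a| → 1`, which later forces weak cluster points of their images to be zero. -/
theorem norm_peak_le {p : ℝ} (hp : 1 ≤ p) {a z : ℂ} (ha : a ∈ ball (0 : ℂ) 1)
    (hz : z ∈ ball (0 : ℂ) 1) : ‖peak p a z‖ ≤ (1 - ‖a‖) / (1 - ‖z‖) ^ 4 := by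
  have hp0 : 0 < p := by linarith
  rw [norm_peak_apply ha hz]
  rw [mem_ball_zero_iff] at ha hz
  have hz0 : 0 < 1 - ‖z‖ := by linarith
  have h1 : 1 - ‖z‖ ≤ ‖1 - (starRingEnd ℂ) a * z‖ := by
    refine le_trans ?_ (one_sub_mul_le_norm a z)
    nlinarith [norm_nonneg a, norm_nonneg z]
  have h2 : (1 - ‖a‖) ^ (3 - 1 / p) ≤ 1 - ‖a‖ := by
    have hle : 1 / p ≤ 1 := by rw [div_le_one hp0]; exact hp
    have := Real.rpow_le_rpow_of_exponent_ge (show 0 < 1 - ‖a‖ by linarith)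
      (by linarith [norm_nonneg a]) (show 1 ≤ 3 - 1 / p by linarith)
    rwa [Real.rpow_one] at this
  have h3 : 0 ≤ (1 - ‖a‖) ^ (3 - 1 / p) := Real.rpow_nonneg (by linarith) _
  gcongr
  linarith

/-- At `z = a` the base of the denominator is `1 - |a|² ≤ 2 (1 - |a|)`, and `16 * 2^4 = 256`. The
exponent is one less than in the derivative estimate, leaving one factor `1 - |a|` for `g'`. -/
theorem le_norm_peak_self {p : ℝ} {a : ℂ} (ha : a ∈ ball (0 : ℂ) 1) :
    1 / 256 ≤ ‖peak p a a‖ * (1 - ‖a‖) ^ (1 + 1 / p) := by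
  rw [norm_peak_apply ha ha]
  rw [mem_ball_zero_iff] at ha
  have hδ0 : 0 < 1 - ‖a‖ := by linarith
  have h1 : ‖1 - (starRingEnd ℂ) a * a‖ ≤ 2 * (1 - ‖a‖) := by
    have e : 1 - (starRingEnd ℂ) a * a = ((1 - ‖a‖ ^ 2 : ℝ) : ℂ) := by
      rw [Complex.conj_mul']; push_cast; rfl
    have h0 : 0 ≤ 1 - ‖a‖ ^ 2 := by nlinarith [norm_nonneg a]
    rw [e, Complex.norm_real, Real.norm_of_nonneg h0]
    nlinarith [norm_nonneg a]
  have h2 : 0 < ‖1 - (starRingEnd ℂ) a * a‖ := by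
    rw [norm_pos_iff]
    exact one_sub_conj_mul_ne_zero (mem_ball_zero_iff.2 ha) (mem_ball_zero_iff.2 ha)
  rw [div_div, div_mul_eq_mul_div, ← Real.rpow_add hδ0, show 3 - 1 / p + (1 + 1 / p) = (4 : ℕ) by
    push_cast; ring, Real.rpow_natCast, div_le_div_iff₀ (by norm_num) (by positivity)]
  have := pow_le_pow_left₀ h2.le h1 4
  calc _ = 16 * ‖1 - (starRingEnd ℂ) a * a‖ ^ 4 := by ring
    _ ≤ 16 * (2 * (1 - ‖a‖)) ^ 4 := by gcongr
    _ = _ := by ring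

theorem norm_integrationOperator_le {g f : ℂ → ℂ} {z : ℂ} {M : ℝ}
    (h : ∀ s ∈ Set.Icc (0 : ℝ) 1, ‖f ((s : ℂ) * z) * deriv g ((s : ℂ) * z) * z‖ ≤ M) :
    ‖integrationOperator g f z‖ ≤ M := by
  have := intervalIntegral.norm_integral_le_of_norm_le_const (a := (0 : ℝ)) (b := 1) (C := M)
    (f := fun s : ℝ => f ((s : ℂ) * z) * deriv g ((s : ℂ) * z) * z) fun s hs => by
      rw [Set.uIoc_of_le zero_le_one] at hs
      exact h s ⟨hs.1.le, hs.2⟩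
  simpa [integrationOperator] using this

namespace RM

variable {p : ℝ} [hp : Fact (1 ≤ p)]

/-- The peak functions as elements of `RM(p,1)`. -/
noncomputable def peakRM (p : ℝ) [hp : Fact (1 ≤ p)] (a : ℂ) (ha : a ∈ ball (0 : ℂ) 1) : RM p 1 :=
  ofMem (peak p a) ⟨differentiableOn_peak p ha, fun _ hz => Set.indicator_of_notMem hz _,
    (rho_peak_le hp.out ha).trans_lt ENNReal.one_lt_top⟩

theorem norm_peakRM_le {a : ℂ} (ha : a ∈ ball (0 : ℂ) 1) : ‖peakRM p a ha‖ ≤ 1 := by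
  have h : rho p 1 (peakRM p a ha) ≤ 1 := rho_peak_le hp.out ha
  rw [rho_eq_ofReal_norm] at h
  rwa [← ENNReal.ofReal_le_one]

/-- The operator acts ray by ray, so the images inherit the angular concentration of the peaks. -/
theorem radial_integrationCLM_peakRM_le {g : ℂ → ℂ} (hg : g ∈ blochSpace) {C : ℝ} (hC : 0 < C)
    (hgC : ∀ z ∈ ball (0 : ℂ) 1, ‖deriv g z‖ ≤ C / (1 - ‖z‖)) {a : ℂ} (ha : a ∈ ball (0 : ℂ) 1)
    (t : ℝ) :
    radial p (integrationCLM g hg (peakRM p a ha)) t ≤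
      ENNReal.ofReal (C * p * ((1 - ‖a‖) / ‖Complex.exp ((t : ℂ) * Complex.I) - a‖ ^ 2)) := by
  have hp0 : 0 < p := by linarith [hp.out]
  rw [coe_integrationCLM]
  refine (radial_integrationExt_le hp.out (peakRM p a ha).measurable le_rfl hC.le
    (fun z hz => ?_) t).trans ?_
  · calc _ ≤ ‖peakRM p a ha z‖ * (C / (1 - ‖z‖)) := by gcongr; exact hgC z hz
      _ = _ := by ring
  · rw [ENNReal.ofReal_zero, zero_add, ENNReal.ofReal_mul (by positivity),
      ENNReal.ofReal_mul hC.le, mul_assoc]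
    gcongr
    exact radial_peak_le hp.out ha t

theorem norm_integrationCLM_peakRM_apply_le {g : ℂ → ℂ} (hg : g ∈ blochSpace) {C : ℝ} (hC : 0 < C)
    (hgC : ∀ z ∈ ball (0 : ℂ) 1, ‖deriv g z‖ ≤ C / (1 - ‖z‖)) {a : ℂ} (ha : a ∈ ball (0 : ℂ) 1)
    {z : ℂ} (hz : z ∈ ball (0 : ℂ) 1) :
    ‖integrationCLM g hg (peakRM p a ha) z‖ ≤ C / (1 - ‖z‖) ^ 5 * (1 - ‖a‖) := by
  rw [coe_integrationCLM, integrationExt_apply _ _ hz]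
  refine norm_integrationOperator_le fun s hs => ?_
  have hw := mul_mem_ball_of_mem_Icc hz hs
  have ha1 := mem_ball_zero_iff.1 ha
  have hz1 := mem_ball_zero_iff.1 hz
  have hw1 : ‖(s : ℂ) * z‖ ≤ ‖z‖ := by
    rw [norm_mul, Complex.norm_real, Real.norm_of_nonneg hs.1]
    exact mul_le_of_le_one_left (norm_nonneg _) hs.2
  have hz0 : 0 < 1 - ‖z‖ := by linarith
  have hδ0 : 0 < 1 - ‖a‖ := by linarith
  rw [norm_mul, norm_mul]
  calc _ ≤ (1 - ‖a‖) / (1 - ‖z‖) ^ 4 * (C / (1 - ‖z‖)) * 1 := by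
        gcongr
        · refine (norm_peak_le hp.out ha hw).trans ?_
          gcongr
        · refine (hgC _ hw).trans ?_
          gcongr
    _ = _ := by field_simp

/-- The derivative of `T_g f` is `f g'`; the derivative estimate is applied at `a`, where the peak
is large. The constant is `2 * 256 * 128`, with the `2` from `1 - |a|² ≤ 2 (1 - |a|)`. -/
theorem le_norm_integrationCLM_peakRM {g : ℂ → ℂ} (hg : g ∈ blochSpace) {a : ℂ}
    (ha : a ∈ ball (0 : ℂ) 1) :
    (1 - ‖a‖ ^ 2) * ‖deriv g a‖ / (65536 * Real.pi) ≤ ‖integrationCLM g hg (peakRM p a ha)‖ := by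
  have ha1 := mem_ball_zero_iff.1 ha
  have hδ0 : 0 < 1 - ‖a‖ := by linarith
  have h := (integrationCLM g hg (peakRM p a ha)).norm_deriv_mul_le ha
  rw [coe_integrationCLM, (hasDerivAt_integrationExt hg.1
    (peakRM p a ha).differentiableOn ha).deriv, norm_mul] at h
  have h1 : 1 / 256 ≤ ‖peakRM p a ha a‖ * (1 - ‖a‖) ^ (1 + 1 / p) := le_norm_peak_self ha
  rw [show 2 + 1 / p = 1 + 1 / p + 1 by ring, Real.rpow_add hδ0, Real.rpow_one] at h
  have h2 : (1 - ‖a‖) * ‖deriv g a‖ ≤ 32768 * Real.pi *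
      ‖integrationCLM g hg (peakRM p a ha)‖ := by
    have h3 : 1 / 256 * ((1 - ‖a‖) * ‖deriv g a‖) ≤
        (‖peakRM p a ha a‖ * (1 - ‖a‖) ^ (1 + 1 / p)) * ((1 - ‖a‖) * ‖deriv g a‖) := by
      gcongr
    nlinarith
  have h4 : (1 - ‖a‖ ^ 2) * ‖deriv g a‖ ≤ 2 * ((1 - ‖a‖) * ‖deriv g a‖) := by
    rw [← mul_assoc]
    gcongr
    nlinarith [norm_nonneg a]
  rw [div_le_iff₀ (by positivity)]
  linarith

end RM

/-! ### Gliding hump and separating functionals -/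

namespace RM

variable {p : ℝ} [hp : Fact (1 ≤ p)]

theorem lintegral_radial (f : RM p 1) :
    ∫⁻ t in Set.Ico (0 : ℝ) (2 * Real.pi), radial p f t = ENNReal.ofReal (2 * Real.pi * ‖f‖) := by
  rw [lintegral_radial_eq, rho_eq_ofReal_norm, ← ENNReal.ofReal_mul (by positivity)]

theorem radial_sum_le {ι : Type*} (s : Finset ι) (x : ι → RM p 1) (t : ℝ) :
    radial p (∑ j ∈ s, x j : RM p 1) t ≤ ∑ j ∈ s, radial p (x j) t := by
  refine Finset.le_sum_of_subadditive (fun f : RM p 1 => radial p f t) ?_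
    (fun f g => radial_add_le hp.out f.measurable g.measurable t) s x
  have h := radial_smul hp.out (0 : ℂ) (0 : ℂ → ℂ) t
  rw [zero_smul, enorm_zero, zero_mul] at h
  exact h.le

theorem radial_real_smul {c : ℝ} (hc : 0 ≤ c) (f : RM p 1) (t : ℝ) :
    radial p (c • f : RM p 1) t = ENNReal.ofReal c * radial p f t := by
  have h := radial_smul hp.out (c : ℂ) f t
  rw [← ofReal_norm, Complex.norm_real, Real.norm_of_nonneg hc] at h
  exact h

/-- Elements living essentially on disjoint angular sets have large convex combinations. -/
theorem le_norm_sum_of_angular_disjoint {x : ℕ → RM p 1} {A : ℕ → Set ℝ}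
    (hA : ∀ j, MeasurableSet (A j)) (hdisj : Pairwise (Function.onFun Disjoint A)) {c : ℝ}
    (hc : 0 ≤ c) (hM : ∀ j, 4 * c ≤ 2 * Real.pi * ‖x j‖)
    (hoff : ∀ j, ∫⁻ t in Set.Ico (0 : ℝ) (2 * Real.pi), (A j)ᶜ.indicator (radial p (x j)) t ≤
      ENNReal.ofReal c) (s : Finset ℕ) {w : ℕ → ℝ} (hw : ∀ j ∈ s, 0 ≤ w j)
    (hw1 : ∑ j ∈ s, w j = 1) :
    2 * c ≤ 2 * Real.pi * ‖∑ j ∈ s, w j • x j‖ := by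
  classical
  set y := ∑ j ∈ s, w j • x j with hy
  -- At most one `A k` contains `t`. The triangle inequality isolates its term, and every other term
  -- is counted once in that inequality and once in the full sum, hence the factor `2`.
  have hpt : ∀ t, ∑ j ∈ s, ENNReal.ofReal (w j) * radial p (x j) t ≤
      radial p y t + 2 * ∑ j ∈ s, ENNReal.ofReal (w j) * (A j)ᶜ.indicator (radial p (x j)) t := by
    intro t
    by_cases hk : ∃ k ∈ s, t ∈ A k
    · obtain ⟨k, hks, hk⟩ := hk
      have hoffk : ∀ j ∈ s.erase k, (A j)ᶜ.indicator (radial p (x j)) t = radial p (x j) t := by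
        intro j hj
        refine Set.indicator_of_mem (fun hj' => ?_) _
        exact Set.disjoint_left.1 (hdisj (Finset.ne_of_mem_erase hj)) hj' hk
      set S := ∑ j ∈ s.erase k, ENNReal.ofReal (w j) * radial p (x j) t with hS
      have h1 : S ≤ ∑ j ∈ s, ENNReal.ofReal (w j) * (A j)ᶜ.indicator (radial p (x j)) t := by
        calc S = ∑ j ∈ s.erase k, ENNReal.ofReal (w j) * (A j)ᶜ.indicator (radial p (x j)) t :=
              Finset.sum_congr rfl fun j hj => by rw [hoffk j hj]
          _ ≤ _ := Finset.sum_le_sum_of_subset (Finset.erase_subset _ _)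
      have h2 : w k • x k = y + ∑ j ∈ s.erase k, (-1 : ℂ) • (w j • x j) := by
        rw [hy, ← Finset.add_sum_erase s _ hks, ← Finset.smul_sum, neg_one_smul]
        abel
      have h3 : ENNReal.ofReal (w k) * radial p (x k) t ≤ radial p y t + S := by
        rw [← radial_real_smul (hw k hks), h2]
        refine (radial_add_le hp.out y.measurable (RM.measurable _) t).trans ?_
        gcongr
        refine (radial_sum_le _ _ t).trans (Finset.sum_le_sum fun j hj => ?_)
        have h := radial_smul hp.out (-1 : ℂ) (w j • x j : RM p 1) t
        rw [enorm_neg, enorm_one, one_mul, radial_real_smul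
          (hw j (Finset.mem_of_mem_erase hj))] at h
        exact h.le
      rw [← Finset.add_sum_erase s _ hks]
      calc _ ≤ (radial p y t + S) + S := by gcongr
        _ = radial p y t + 2 * S := by ring
        _ ≤ _ := by gcongr
    · push Not at hk
      have e : ∀ j ∈ s, (A j)ᶜ.indicator (radial p (x j)) t = radial p (x j) t :=
        fun j hj => Set.indicator_of_mem (hk j hj) _
      have e' : ∑ j ∈ s, ENNReal.ofReal (w j) * (A j)ᶜ.indicator (radial p (x j)) t =
          ∑ j ∈ s, ENNReal.ofReal (w j) * radial p (x j) t :=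
        Finset.sum_congr rfl fun j hj => by rw [e j hj]
      rw [e', two_mul]
      exact le_add_left (le_add_right le_rfl)
  have hmr : ∀ j, Measurable (radial p (x j)) := fun j => measurable_radial p (x j).measurable
  have hint := lintegral_mono (μ := volume.restrict (Set.Ico (0 : ℝ) (2 * Real.pi))) hpt
  rw [lintegral_finsetSum _ fun j _ => (hmr j).const_mul _,
    lintegral_add_left (measurable_radial p y.measurable), lintegral_const_mul' _ _ (by finiteness),
    lintegral_finsetSum _ fun j _ => ((hmr j).indicator (hA j).compl).const_mul _,
    lintegral_radial] at hint
  simp only [lintegral_const_mul' _ _ ENNReal.ofReal_ne_top, lintegral_radial] at hint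
  have h1 : ENNReal.ofReal (4 * c) ≤
      ∑ j ∈ s, ENNReal.ofReal (w j) * ENNReal.ofReal (2 * Real.pi * ‖x j‖) := by
    calc ENNReal.ofReal (4 * c) = ∑ j ∈ s, ENNReal.ofReal (w j) * ENNReal.ofReal (4 * c) := by
          rw [← Finset.sum_mul, ← ENNReal.ofReal_sum_of_nonneg hw, hw1, ENNReal.ofReal_one, one_mul]
      _ ≤ _ := by
          exact Finset.sum_le_sum fun j _ => mul_le_mul_right (ENNReal.ofReal_le_ofReal (hM j)) _
  have h2 : ∑ j ∈ s, ENNReal.ofReal (w j) *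
      ∫⁻ t in Set.Ico (0 : ℝ) (2 * Real.pi), (A j)ᶜ.indicator (radial p (x j)) t ≤
      ENNReal.ofReal c := by
    calc _ ≤ ∑ j ∈ s, ENNReal.ofReal (w j) * ENNReal.ofReal c := by
          gcongr with j _
          exact hoff j
      _ = _ := by
          rw [← Finset.sum_mul, ← ENNReal.ofReal_sum_of_nonneg hw, hw1, ENNReal.ofReal_one, one_mul]
  -- The total mass `4c` exceeds the doubled error `2c`, leaving `2c` for the norm of the
  -- combination.
  have h3 : ENNReal.ofReal (4 * c) ≤
      ENNReal.ofReal (2 * Real.pi * ‖y‖) + 2 * ENNReal.ofReal c := by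
    refine h1.trans (hint.trans ?_)
    gcongr
  rw [show (2 : ℝ≥0∞) = ENNReal.ofReal 2 by norm_num, ← ENNReal.ofReal_mul (by norm_num),
    ← ENNReal.ofReal_add (by positivity) (by positivity),
    ENNReal.ofReal_le_ofReal_iff (by positivity)] at h3
  linarith

/-- A functional bounded below on a sequence with essentially disjoint angular supports. -/
theorem exists_functional_of_angular_disjoint {x : ℕ → RM p 1} {A : ℕ → Set ℝ}
    (hA : ∀ j, MeasurableSet (A j)) (hdisj : Pairwise (Function.onFun Disjoint A)) {c : ℝ}
    (hc : 0 < c) (hM : ∀ j, 4 * c ≤ 2 * Real.pi * ‖x j‖)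
    (hoff : ∀ j, ∫⁻ t in Set.Ico (0 : ℝ) (2 * Real.pi), (A j)ᶜ.indicator (radial p (x j)) t ≤
      ENNReal.ofReal c) :
    ∃ (φ : StrongDual ℂ (RM p 1)) (u : ℝ), 0 < u ∧ ∀ j, u < (φ (x j)).re := by
  set S : Set (RM p 1) := Finsupp.linearCombination ℝ x '' {w | 0 ≤ w ∧ w.sum (fun _ a => a) = 1}
    with hS
  have hconv : Convex ℝ S := by
    refine Convex.linear_image ?_ _
    rintro v ⟨hv, hv1⟩ w ⟨hw, hw1⟩ a b ha hb hab
    refine ⟨add_nonneg (smul_nonneg ha hv) (smul_nonneg hb hw), ?_⟩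
    have e : ∀ u : ℕ →₀ ℝ, u.sum (fun _ a => a) = Finsupp.linearCombination ℝ (fun _ => (1 : ℝ)) u :=
      fun u => by simp [Finsupp.linearCombination_apply]
    rw [e] at *
    rw [map_add, map_smul, map_smul, hv1, hw1]
    simpa using hab
  have hx : ∀ j, x j ∈ S := fun j => ⟨Finsupp.single j 1, ⟨by simp, by simp⟩, by simp⟩
  have hnorm : ∀ y ∈ S, 2 * c ≤ 2 * Real.pi * ‖y‖ := by
    rintro _ ⟨w, ⟨hw, hw1⟩, rfl⟩
    rw [Finsupp.linearCombination_apply]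
    exact le_norm_sum_of_angular_disjoint hA hdisj hc.le hM hoff w.support (fun j _ => hw j) hw1
  have hcl : closure S ⊆ {y | 2 * c ≤ 2 * Real.pi * ‖y‖} :=
    closure_minimal hnorm (isClosed_le continuous_const (by fun_prop))
  have h0 : (0 : RM p 1) ∉ closure S := fun h => by
    have := hcl h
    simp only [Set.mem_ofPred_eq, norm_zero, mul_zero] at this
    linarith
  -- The closed convex hull of the sequence misses the origin, so it can be strictly separated from
  -- it.
  obtain ⟨φ, u, hu, hφ⟩ := RCLike.geometric_hahn_banach_point_closed (𝕜 := ℂ) hconv.closure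
    isClosed_closure h0
  rw [map_zero, map_zero] at hu
  exact ⟨φ, u, hu, fun j => hφ _ (subset_closure (hx j))⟩

/-- Dominated convergence for one fixed `f`: only countably many angles satisfy `e^{it} = ζ`. -/
theorem tendsto_lintegral_indicator_near (f : RM p 1) (ζ : ℂ) :
    Tendsto (fun m : ℕ => ∫⁻ t in Set.Ico (0 : ℝ) (2 * Real.pi),
      {t : ℝ | ‖Complex.exp ((t : ℂ) * Complex.I) - ζ‖ < 1 / ((m : ℝ) + 1)}.indicator
        (radial p f) t) atTop (𝓝 0) := by
  have hG : Continuous fun t : ℝ => ‖Complex.exp ((t : ℂ) * Complex.I) - ζ‖ := by fun_prop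
  have hm := measurable_radial p f.measurable
  have h := tendsto_lintegral_of_dominated_convergence
    (μ := volume.restrict (Set.Ico (0 : ℝ) (2 * Real.pi)))
    (F := fun m : ℕ => {t : ℝ | ‖Complex.exp ((t : ℂ) * Complex.I) - ζ‖ <
      1 / ((m : ℝ) + 1)}.indicator (radial p f)) (f := fun _ => 0) (radial p f)
    (fun m => hm.indicator (hG.measurable measurableSet_Iio))
    (fun m => Eventually.of_forall fun t => Set.indicator_le_self _ _ t)
    (by rw [lintegral_radial]; finiteness) ?_
  · simpa using h
  · refine ae_restrict_of_ae ?_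
    have hnull : volume {t : ℝ | Complex.exp ((t : ℂ) * Complex.I) = ζ} = 0 := by
      refine Set.Countable.measure_zero ?_ _
      have := (Set.countable_singleton ζ).preimage_circleMap 0 one_ne_zero
      refine this.mono fun t ht => ?_
      simpa [circleMap] using ht
    filter_upwards [measure_eq_zero_iff_ae_notMem.1 hnull] with t ht
    have hpos : 0 < ‖Complex.exp ((t : ℂ) * Complex.I) - ζ‖ := by
      rw [norm_pos_iff, sub_ne_zero]; exact ht
    have hev := (tendsto_one_div_add_atTop_nhds_zero_nat (𝕜 := ℝ)).eventually (gt_mem_nhds hpos)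
    refine tendsto_const_nhds.congr' ?_
    filter_upwards [hev] with m hm
    rw [Set.indicator_of_notMem]
    simp only [Set.mem_ofPred_eq, not_lt]
    exact hm.le

/-- Once `a n` is within `η / 2` of `ζ`, the denominator of the kernel is at least `(η / 2)²` on
these angles, while the numerator `1 - |a n|` tends to zero. -/
theorem tendsto_lintegral_indicator_away {x : ℕ → RM p 1} {a : ℕ → ℂ}
    {ζ : ℂ} (hζ : ‖ζ‖ = 1) (haζ : Tendsto a atTop (𝓝 ζ)) {B : ℝ} (hB : 0 ≤ B)
    (ha : ∀ n, a n ∈ ball (0 : ℂ) 1)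
    (hx : ∀ n t, radial p (x n) t ≤ ENNReal.ofReal
      (B * ((1 - ‖a n‖) / ‖Complex.exp ((t : ℂ) * Complex.I) - a n‖ ^ 2))) {η : ℝ} (hη : 0 < η) :
    Tendsto (fun n : ℕ => ∫⁻ t in Set.Ico (0 : ℝ) (2 * Real.pi),
      {t : ℝ | η ≤ ‖Complex.exp ((t : ℂ) * Complex.I) - ζ‖}.indicator
        (radial p (x n)) t) atTop (𝓝 0) := by
  have hlim : Tendsto (fun n => ENNReal.ofReal (B * ((1 - ‖a n‖) / (η / 2) ^ 2)) *
      ENNReal.ofReal (2 * Real.pi)) atTop (𝓝 0) := by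
    have h1 : Tendsto (fun n => B * ((1 - ‖a n‖) / (η / 2) ^ 2)) atTop (𝓝 0) := by
      have := ((haζ.norm.const_sub 1).div_const ((η / 2) ^ 2)).const_mul B
      simpa [hζ] using this
    have := ENNReal.Tendsto.mul_const (ENNReal.tendsto_ofReal h1)
      (b := ENNReal.ofReal (2 * Real.pi)) (Or.inr ENNReal.ofReal_ne_top)
    simpa using this
  refine tendsto_of_tendsto_of_tendsto_of_le_of_le' tendsto_const_nhds hlim
    (Eventually.of_forall fun _ => zero_le) ?_
  filter_upwards [(Metric.tendsto_nhds.1 haζ) (η / 2) (half_pos hη)] with n hn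
  calc _ ≤ ∫⁻ t in Set.Ico (0 : ℝ) (2 * Real.pi),
        ENNReal.ofReal (B * ((1 - ‖a n‖) / (η / 2) ^ 2)) := by
        refine lintegral_mono fun t => ?_
        rw [Set.indicator_apply]
        split_ifs with ht
        swap
        · exact zero_le
        refine (hx n t).trans ?_
        apply ENNReal.ofReal_le_ofReal
        have h1 := mem_ball_zero_iff.1 (ha n)
        rw [dist_eq_norm] at hn
        have h2 : η / 2 ≤ ‖Complex.exp ((t : ℂ) * Complex.I) - a n‖ := by
          have h3 := norm_sub_le_norm_sub_add_norm_sub (Complex.exp ((t : ℂ) * Complex.I)) (a n) ζ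
          simp only [Set.mem_ofPred_eq] at ht
          linarith
        have h4 : 0 ≤ 1 - ‖a n‖ := by linarith
        gcongr
    _ = _ := by rw [setLIntegral_const, Real.volume_Ico, sub_zero]

/-- Gliding hump: a sequence bounded below and concentrating at a boundary point has a subsequence
on which some functional is bounded below. -/
theorem exists_functional_of_concentrating {x : ℕ → RM p 1} {a : ℕ → ℂ}
    {ζ : ℂ} (hζ : ‖ζ‖ = 1) (haζ : Tendsto a atTop (𝓝 ζ)) {B : ℝ} (hB : 0 ≤ B)
    (ha : ∀ n, a n ∈ ball (0 : ℂ) 1)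
    (hx : ∀ n t, radial p (x n) t ≤ ENNReal.ofReal
      (B * ((1 - ‖a n‖) / ‖Complex.exp ((t : ℂ) * Complex.I) - a n‖ ^ 2)))
    {b : ℝ} (hb : 0 < b) (hxb : ∀ n, b ≤ ‖x n‖) :
    ∃ (n : ℕ → ℕ) (φ : StrongDual ℂ (RM p 1)) (u : ℝ), Tendsto n atTop atTop ∧ 0 < u ∧
      ∀ j, u < (φ (x (n j))).re := by
  -- Makes `4c = 2πb`, the lower bound for the angular mass.
  set c := Real.pi * b / 2 with hc
  have hc0 : 0 < c := by positivity
  set G : ℝ → ℝ := fun t => ‖Complex.exp ((t : ℂ) * Complex.I) - ζ‖ with hG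
  have hGc : Continuous G := by fun_prop
  have hc2 : 0 < ENNReal.ofReal (c / 2) := ENNReal.ofReal_pos.2 (half_pos hc0)
  -- Given an outer radius `η`, first `n` is taken so large that little mass lies outside it; then
  -- `η'` is taken so small that this one function has little mass inside it. What remains lives on
  -- the shell `η' ≤ G < η`.
  have select : ∀ (N : ℕ) (η : Set.Ioi (0 : ℝ)), ∃ (n : ℕ) (η' : Set.Ioi (0 : ℝ)),
      N ≤ n ∧ (η' : ℝ) ≤ η ∧ ∫⁻ t in Set.Ico (0 : ℝ) (2 * Real.pi),
        {t | (η' : ℝ) ≤ G t ∧ G t < η}ᶜ.indicator (radial p (x n)) t ≤ ENNReal.ofReal c := by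
    rintro N ⟨η, hη⟩
    have h1 := (tendsto_lintegral_indicator_away hζ haζ hB ha hx hη).eventually (gt_mem_nhds hc2)
    obtain ⟨n, hn, hNn⟩ := (h1.and (eventually_ge_atTop N)).exists
    have h2 := (tendsto_lintegral_indicator_near (x n) ζ).eventually (gt_mem_nhds hc2)
    have h3 := (tendsto_one_div_add_atTop_nhds_zero_nat (𝕜 := ℝ)).eventually
      (gt_mem_nhds (show (0 : ℝ) < η from hη))
    obtain ⟨m, hm, hmη⟩ := (h2.and h3).exists
    refine ⟨n, ⟨1 / ((m : ℝ) + 1), Set.mem_Ioi.2 Nat.one_div_pos_of_nat⟩, hNn, hmη.le, ?_⟩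
    rw [← add_halves c, ENNReal.ofReal_add (by positivity) (by positivity)]
    refine le_trans ?_ (add_le_add hm.le hn.le)
    have hmr := measurable_radial p (x n).measurable
    have hml : Measurable ({t : ℝ | ‖Complex.exp ((t : ℂ) * Complex.I) - ζ‖ <
        1 / ((m : ℝ) + 1)}.indicator (radial p (x n))) :=
      hmr.indicator (hGc.measurable measurableSet_Iio)
    rw [← lintegral_add_left hml]
    refine lintegral_mono fun t => ?_
    by_cases h1 : G t < 1 / ((m : ℝ) + 1)
    · rw [Set.indicator_of_mem (show t ∈ {t | G t < 1 / ((m : ℝ) + 1)} from h1)]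
      exact le_add_right (Set.indicator_le_self _ _ t)
    · by_cases h2 : η ≤ G t
      · rw [Set.indicator_of_mem (show t ∈ {t | η ≤ G t} from h2)]
        exact le_add_left (Set.indicator_le_self _ _ t)
      · rw [Set.indicator_of_notMem]
        · exact zero_le
        · simp only [Set.mem_compl_iff, Set.mem_ofPred_eq, not_not]
          exact ⟨not_lt.1 h1, not_le.1 h2⟩
  choose n η' hn hη' hoff using select
  -- Each inner radius becomes the next outer radius, so the shells are disjoint; using `k` as the
  -- lower bound for the `k`-th index sends the indices to infinity.
  let e : ℕ → Set.Ioi (0 : ℝ) := fun k => Nat.rec ⟨1, Set.mem_Ioi.2 one_pos⟩ (fun k η => η' k η) k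
  have he : ∀ k, e (k + 1) = η' k (e k) := fun k => rfl
  have hanti : Antitone fun k => (e k).1 :=
    antitone_nat_of_succ_le fun k => by rw [he]; exact hη' k (e k)
  set A : ℕ → Set ℝ := fun k => {t | (e (k + 1)).1 ≤ G t ∧ G t < (e k).1} with hA
  have hAm : ∀ k, MeasurableSet (A k) := fun k =>
    (hGc.measurable measurableSet_Ici).inter (hGc.measurable measurableSet_Iio)
  have hdisj : Pairwise (Function.onFun Disjoint A) := by
    rw [pairwise_disjoint_on]
    intro i j hij
    refine Set.disjoint_left.2 fun t hi hj => ?_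
    have h1 : (e j).1 ≤ (e (i + 1)).1 := hanti hij
    exact absurd (hi.1.trans_lt hj.2) (not_lt.2 h1)
  have hM : ∀ j, 4 * c ≤ 2 * Real.pi * ‖x (n j (e j))‖ := fun j => by
    have := hxb (n j (e j))
    rw [hc]
    nlinarith [Real.pi_pos]
  obtain ⟨φ, u, hu, hφ⟩ := exists_functional_of_angular_disjoint
    (x := fun k => x (n k (e k))) hAm hdisj hc0 hM (fun j => hoff j (e j))
  exact ⟨fun k => n k (e k), φ, u, tendsto_atTop_mono (fun k => hn k (e k)) tendsto_id, hu, hφ⟩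

end RM

/-! ### Weak compactness and the equivalence -/

theorem IsCompactOperator.isWeaklyCompactOperator {E F : Type*} [NormedAddCommGroup E]
    [NormedSpace ℂ E] [NormedAddCommGroup F] [NormedSpace ℂ F] {T : E →L[ℂ] F}
    (hT : IsCompactOperator T) : IsWeaklyCompactOperator T := by
  obtain ⟨K, hK, hTK⟩ := IsCompactOperator.image_closedBall_subset_compact
    (f := (T : E →ₗ[ℂ] F)) hT 1
  refine (hK.image (toWeakSpaceCLM ℂ F).continuous).closure_of_subset ?_
  rintro _ ⟨x, hx, rfl⟩
  exact ⟨T x, hTK ⟨x, hx, rfl⟩, rfl⟩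

/-- Failure of the limit gives a bad sequence with `|a n| → 1`; compactness of the closed disc makes
a subsequence converge to a single boundary point, as angular concentration requires. -/
theorem exists_seq_of_notMem_littleBlochSpace {g : ℂ → ℂ} (hg : g ∈ blochSpace)
    (hg0 : g ∉ littleBlochSpace) :
    ∃ ε > 0, ∃ (a : ℕ → ℂ) (ζ : ℂ), (∀ n, a n ∈ ball (0 : ℂ) 1) ∧ ‖ζ‖ = 1 ∧
      Tendsto a atTop (𝓝 ζ) ∧ ∀ n, ε ≤ (1 - ‖a n‖ ^ 2) * ‖deriv g (a n)‖ := by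
  have h : ¬ Tendsto (fun z : ℂ => (1 - ‖z‖ ^ 2) * ‖deriv g z‖)
      (comap (fun z : ℂ => ‖z‖) (𝓝[<] 1)) (𝓝 0) := fun h => hg0 ⟨hg, h⟩
  rw [Metric.tendsto_nhds] at h
  push Not at h
  obtain ⟨ε, hε, h⟩ := h
  have hlt : ∀ᶠ z : ℂ in comap (fun z : ℂ => ‖z‖) (𝓝[<] 1), ‖z‖ < 1 :=
    tendsto_comap.eventually self_mem_nhdsWithin
  obtain ⟨a, ha, haP⟩ := exists_seq_forall_of_frequently (h.and_eventually hlt)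
  have hnorm : Tendsto (fun n => ‖a n‖) atTop (𝓝 1) :=
    (tendsto_comap.comp ha).mono_right nhdsWithin_le_nhds
  obtain ⟨ζ, -, φ, hφ, hlim⟩ := (isCompact_closedBall (0 : ℂ) 1).tendsto_subseq
    (x := a) fun n => mem_closedBall_zero_iff.2 (haP n).2.le
  refine ⟨ε, hε, a ∘ φ, ζ, fun n => mem_ball_zero_iff.2 (haP _).2,
    tendsto_nhds_unique hlim.norm (hnorm.comp hφ.tendsto_atTop), hlim, fun n => ?_⟩
  have h1 := (haP (φ n)).1
  have h2 := (haP (φ n)).2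
  rw [dist_zero_right, Real.norm_of_nonneg
    (mul_nonneg (by nlinarith [norm_nonneg (a (φ n))]) (norm_nonneg _))] at h1
  exact h1

namespace RM

variable {p : ℝ} [hp : Fact (1 ≤ p)]

theorem mem_littleBlochSpace_of_isWeaklyCompactOperator {g : ℂ → ℂ} (hg : g ∈ blochSpace)
    (hT : IsWeaklyCompactOperator (integrationCLM g hg : RM p 1 →L[ℂ] RM p 1)) :
    g ∈ littleBlochSpace := by
  by_contra hg0
  have hp0 : 0 < p := by linarith [hp.out]
  obtain ⟨C, hC, hgC⟩ := exists_norm_deriv_le_of_mem_blochSpace hg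
  obtain ⟨ε, hε, a, ζ, ha, hζ, haζ, haε⟩ := exists_seq_of_notMem_littleBlochSpace hg hg0
  set x : ℕ → RM p 1 := fun n => integrationCLM g hg (peakRM p (a n) (ha n)) with hx
  obtain ⟨n, φ, u, hn, hu, hφ⟩ := exists_functional_of_concentrating (x := x) hζ haζ
    (B := C * p) (by positivity) ha
    (fun n t => radial_integrationCLM_peakRM_le hg hC hgC (ha n) t)
    (b := ε / (65536 * Real.pi)) (by positivity) fun n => by
      refine le_trans ?_ (le_norm_integrationCLM_peakRM hg (ha n))
      gcongr
      exact haε n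
  -- A weak cluster point suffices; no weakly convergent subsequence is needed.
  obtain ⟨y, -, hy⟩ := IsCompact.exists_mapClusterPt hT (f := atTop)
    (u := fun k => toWeakSpace ℂ (RM p 1) (x (n k))) (Filter.tendsto_principal.2 <|
      Eventually.of_forall fun k => subset_closure ⟨peakRM p (a (n k)) (ha (n k)),
        mem_closedBall_zero_iff.2 (norm_peakRM_le _), rfl⟩)
  let y' : RM p 1 := (toWeakSpace ℂ (RM p 1)).symm y
  have hcluster : ∀ ψ : StrongDual ℂ (RM p 1), MapClusterPt (ψ y') atTop fun k => ψ (x (n k)) := by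
    intro ψ
    have hc : Continuous fun w : WeakSpace ℂ (RM p 1) => ψ ((toWeakSpace ℂ (RM p 1)).symm w) :=
      WeakBilin.eval_continuous (topDualPairing ℂ (RM p 1)).flip ψ
    exact MapClusterPt.continuousAt_comp (f := fun w : WeakSpace ℂ (RM p 1) =>
      ψ ((toWeakSpace ℂ (RM p 1)).symm w)) hc.continuousAt hy
  -- Evaluations are bounded functionals, and the images tend to zero at every point of the disc, so
  -- every value of the cluster point is zero.
  have hy0 : y' = 0 := by
    refine RM.ext fun z hz => ?_
    have h1 := hcluster (evalCLM z hz)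
    have h2 : Tendsto (fun k => evalCLM (p := p) z hz (x (n k))) atTop (𝓝 0) := by
      have h3 : Tendsto (fun k => C / (1 - ‖z‖) ^ 5 * (1 - ‖a (n k)‖)) atTop (𝓝 0) := by
        have := ((haζ.comp hn).norm.const_sub 1).const_mul (C / (1 - ‖z‖) ^ 5)
        simpa [hζ] using this
      exact squeeze_zero_norm
        (fun k => norm_integrationCLM_peakRM_apply_le hg hC hgC (ha (n k)) hz) h3
    exact eq_of_nhds_neBot (ClusterPt.mono h1 h2)
  -- The separating functional gives the cluster point real part at least `u > 0`, contradicting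
  -- that it vanishes.
  have h1 := (hcluster φ).continuousAt_comp Complex.continuous_re.continuousAt
  have h2 : u ≤ (φ y').re := by
    have hcl : IsClosed (Set.Ici u) := isClosed_Ici
    exact hcl.mem_of_mapClusterPt h1 (Eventually.of_forall fun k => (hφ k).le)
  rw [hy0, map_zero, Complex.zero_re] at h2
  linarith

end RM

theorem mainTheorem5 (p : ℝ) [Fact (1 ≤ p)] (g : ℂ → ℂ) (hg : g ∈ blochSpace) :
    ∃ T : RM p 1 →L[ℂ] RM p 1,
      (∀ (f : RM p 1), ∀ z ∈ ball (0 : ℂ) 1, T f z = integrationOperator g f z) ∧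
      (IsWeaklyCompactOperator T ↔ IsCompactOperator T) ∧
      (IsCompactOperator T ↔ g ∈ littleBlochSpace) := by
  have h := RM.isCompactOperator_integrationCLM (p := p) hg
  refine ⟨RM.integrationCLM g hg, fun f z hz => integrationExt_apply g f hz, ?_, ?_, h⟩
  -- Weak compactness yields compactness only by way of the little Bloch condition.
  · exact ⟨fun hw => h (RM.mem_littleBlochSpace_of_isWeaklyCompactOperator hg hw),
      IsCompactOperator.isWeaklyCompactOperator⟩
  · exact fun hc => RM.mem_littleBlochSpace_of_isWeaklyCompactOperator hg hc.isWeaklyCompactOperator
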